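/- Let $\rho$ be a Borel probability measure on $\mathbb R^d$ and let $p\ge 8$ be a multiple of $4$. Suppose $\rho$ has order-$p$ moment bound $M$, meaning $\mathbb E_\rho\|X-\mathbb E_\rho X\|_2^l\le M$ (with these moments existing) for $1\le l\le p$. Let $0<\sigma_1\le\sigma_2$ with $\sigma_1\le 1$, let $c\le 1/2$ be real, let $k\in\mathbb N$ and $\delta>0$. For Gaussian mixture parameters $(\alpha,\Theta)=\{(\alpha_i,\mu_i,\Sigma_i)\}_{i=1}^n$ put $$\phi_{\mathrm g}(x;(\alpha,\Theta)):=\ln\Big(\sum_{i=1}^n\alpha_i p_{\mu_i,\Sigma_i}(x)\Big),\qquad p_{\mu,\Sigma}(x)=\frac{1}{\sqrt{(2\pi)^d|\Sigma|}}\exp\Big(-\tfrac12(x-\mu)^{\top}\Sigma^{-1}(x-\mu)\Big).$$ For a probability measure $\nu$, let $\mathcal S(\nu)$ be the set of all $(\alpha,\Theta)$ with at most $k$ components, $\alpha_i\ge0$, $\sum_i\alpha_i=1$, $\sigma_1I\preceq\Sigma_i\preceq\sigma_2I$ for every $i$, and $\mathbb E_\nu\,\phi_{\mathrm g}(X;(\alpha,\Theta))\ge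 c$. There are universal constants $C$ and $N$ such that, for all data as above, the following holds. If $$m\ge\max\Big\{\big(p/(2^{p/4+2}e)\big)^2,\ 8\ln(1/\delta),\ d^2\ln(\pi\sigma_2)^2\ln(1/\delta)\Big\},$$ then with probability at least $1-5\delta$ over the draw of an i.i.d. sample of size $m$ from $\rho$, with empirical measure $\hat\rho$, every $(\alpha,\Theta)\in\mathcal S(\hat\rho)\cup\mathcal S(\rho)$ has $\phi_{\mathrm g}(\cdot;(\alpha,\Theta))$ integrable under $\rho$ and satisfies $$\Big|\int\phi_{\mathrm g}(x;(\alpha,\Theta))\,d\rho(x)-\int\phi_{\mathrm g}(x;(\alpha,\Theta))\,d\hat\rho(x)\Big|\le K\,m^{-1/2+3/p}\Big(1+\sqrt{\ln m+\ln(1/\delta)}+(1/\delta)^{4/p}\Big),$$ where $K=C\,\big(1+p+d+k+|c|+M+\sigma_2/\sigma_1+1/\sigma_1\big)^{N}$ depends only polynomially on the listed parameters and on no sample-dependent quantity. -/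

import Mathlib

open MeasureTheory

noncomputable section

/-- `ρ` has order-`p` moment bound `M` with respect to the Euclidean norm: the central absolute
moments of orders `1, …, p` exist and are at most `M`.  (Integrability at `l = 1` makes the mean
`∫ y, y ∂ρ` a genuine expectation.) -/
def HasMomentBound {d : ℕ} (ρ : Measure (EuclideanSpace ℝ (Fin d))) (p : ℕ) (M : ℝ) : Prop :=
  ∀ l : ℕ, 1 ≤ l → l ≤ p →
    Integrable (fun x => ‖x - ∫ y, y ∂ρ‖ ^ l) ρ ∧ ∫ x, ‖x - ∫ y, y ∂ρ‖ ^ l ∂ρ ≤ M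

/-- The empirical measure `(1/m) ∑ⱼ δ_{xⱼ}` of a sample of size `m`. -/
def empiricalMeasure {d m : ℕ} (x : Fin m → EuclideanSpace ℝ (Fin d)) :
    Measure (EuclideanSpace ℝ (Fin d)) :=
  (m : ENNReal)⁻¹ • ∑ j, Measure.dirac (x j)

/-- The Gaussian density on `ℝᵈ` with mean `μ` and covariance matrix `S`. -/
def gaussianDensity {d : ℕ} (μ : EuclideanSpace ℝ (Fin d)) (S : Matrix (Fin d) (Fin d) ℝ)
    (x : EuclideanSpace ℝ (Fin d)) : ℝ :=
  1 / Real.sqrt ((2 * Real.pi) ^ d * S.det) *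
    Real.exp (-(1 / 2) * ((x - μ).ofLp ⬝ᵥ (S⁻¹.mulVec (x - μ).ofLp)))

/-- Raw parameters `(α, Θ)` of a mixture with `size` Gaussian components on `ℝᵈ`; the constraints
on the weights and covariances are imposed in `mogClass`. -/
structure MixtureParams (d : ℕ) where
  /-- number of components -/
  size : ℕ
  /-- mixture weights -/
  weight : Fin size → ℝ
  /-- component means -/
  mean : Fin size → EuclideanSpace ℝ (Fin d)
  /-- component covariances -/
  cov : Fin size → Matrix (Fin d) (Fin d) ℝ

/-- The Gaussian mixture score at a point: the logarithm of the mixture density. -/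
def mixtureScore {d : ℕ} (θ : MixtureParams d) (x : EuclideanSpace ℝ (Fin d)) : ℝ :=
  Real.log (∑ i, θ.weight i * gaussianDensity (θ.mean i) (θ.cov i) x)

/-- Parameters of mixtures with at most `k` components, weights in the simplex, covariances with
`σ₁ I ⪯ Σᵢ ⪯ σ₂ I`, whose expected log-likelihood under `ν` is at least `c`.  (The score is bounded
above on this class, so an expectation `≥ c` includes integrability.) -/
def mogClass {d : ℕ} (ν : Measure (EuclideanSpace ℝ (Fin d))) (c : ℝ) (k : ℕ) (σ₁ σ₂ : ℝ) :
    Set (MixtureParams d) :=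
  {θ | θ.size ≤ k ∧
    (∀ i, 0 ≤ θ.weight i) ∧ ∑ i, θ.weight i = 1 ∧
    (∀ i, (θ.cov i - σ₁ • (1 : Matrix (Fin d) (Fin d) ℝ)).PosSemidef ∧
      (σ₂ • (1 : Matrix (Fin d) (Fin d) ℝ) - θ.cov i).PosSemidef) ∧
    Integrable (mixtureScore θ) ν ∧ c ≤ ∫ x, mixtureScore θ x ∂ν}

end

/-!
Outside an event of probability at most `2δ`, half of the sample lies in a ball of radius
polynomial in the parameters around the mean of `ρ`, and `ρ` always puts half of its mass there.
Since a score has expectation at least `c` under one of the two measures, it is bounded below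
somewhere in that ball, and the bounds on the covariances turn this into quadratic growth
`|φ(x)| ≤ A (1 + ‖x - x₀‖²)` with `A` polynomial in the parameters.  Hence every score is
`ρ`-integrable, and by Markov's inequality truncating to a ball of radius
`R = ((M + 1) m / δ)^(1/p)` costs only a tail term of order `R^(2 - p)` and an event of
probability at most `δ`.

On the ball the score is the logarithm of a sum of exponentials of quadratic polynomials.  It is
1-Lipschitz in the exponents for the sup norm, so a finite net of coefficient vectors, of
cardinality exponential in a polynomial of the parameters, approximates all scores uniformly.
Hoeffding's inequality and a union bound over the net give the deviation `R² √(L / m)`, where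
`L` is the logarithm of the cardinality of the net divided by `δ`, of order `m^(1/p) δ^(-1/p)`.
-/

section LoewnerOrder

open Matrix
open scoped MatrixOrder

variable {n : Type*} {a b : ℝ}

lemma dotProduct_mulVec_mono [Fintype n] {A B : Matrix n n ℝ} (h : A ≤ B) (v : n → ℝ) :
    v ⬝ᵥ A *ᵥ v ≤ v ⬝ᵥ B *ᵥ v := by
  have := (le_iff.1 h).dotProduct_mulVec_nonneg v
  rwa [star_trivial, sub_mulVec, dotProduct_sub, sub_nonneg] at this

variable [DecidableEq n] {S : Matrix n n ℝ}

lemma isHermitian_of_smul_one_le (h : a • 1 ≤ S) : S.IsHermitian := by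
  simpa using (le_iff.1 h).isHermitian.add (isHermitian_one.smul (.all a))

lemma posDef_of_smul_one_le (ha : 0 < a) (h : a • 1 ≤ S) : S.PosDef := by
  simpa using (PosDef.one.smul ha).add_posSemidef (le_iff.1 h)

variable [Fintype n]

lemma smul_one_le_iff_le_spectrum (hS : S.IsHermitian) :
    a • 1 ≤ S ↔ ∀ x ∈ spectrum ℝ S, a ≤ x := by
  simpa only [Algebra.algebraMap_eq_smul_one] using
    algebraMap_le_iff_le_spectrum (r := a) (a := S) (ha := hS.isSelfAdjoint)

lemma le_smul_one_iff_spectrum_le (hS : S.IsHermitian) :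
    S ≤ b • 1 ↔ ∀ x ∈ spectrum ℝ S, x ≤ b := by
  simpa only [Algebra.algebraMap_eq_smul_one] using
    le_algebraMap_iff_spectrum_le (r := b) (a := S) (ha := hS.isSelfAdjoint)

lemma pow_card_le_det (ha : 0 ≤ a) (h : a • 1 ≤ S) : a ^ Fintype.card n ≤ S.det := by
  have hS := isHermitian_of_smul_one_le h
  rw [hS.det_eq_prod_eigenvalues, ← Finset.card_univ, ← Finset.prod_const]
  exact Finset.prod_le_prod (fun _ _ => ha) fun i _ =>
    (smul_one_le_iff_le_spectrum hS).1 h _ (hS.eigenvalues_mem_spectrum_real i)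

lemma det_le_pow_card (hS : S.PosSemidef) (h : S ≤ b • 1) : S.det ≤ b ^ Fintype.card n := by
  rw [hS.isHermitian.det_eq_prod_eigenvalues, ← Finset.card_univ, ← Finset.prod_const]
  exact Finset.prod_le_prod (fun i _ => hS.eigenvalues_nonneg i) fun i _ =>
    (le_smul_one_iff_spectrum_le hS.isHermitian).1 h _
      (hS.isHermitian.eigenvalues_mem_spectrum_real i)

lemma inv_mem_spectrum_of_mem_spectrum_inv (hS : IsUnit S) {x : ℝ} (hx : x ∈ spectrum ℝ S⁻¹) :
    x⁻¹ ∈ spectrum ℝ S := by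
  rw [← hS.unit_spec, ← coe_units_inv] at hx
  simpa using spectrum.inv₀_mem_iff.2 hx

lemma inv_le_inv_smul_one (ha : 0 < a) (h : a • 1 ≤ S) : S⁻¹ ≤ a⁻¹ • 1 := by
  have hS := posDef_of_smul_one_le ha h
  refine (le_smul_one_iff_spectrum_le hS.inv.isHermitian).2 fun x hx => ?_
  exact le_inv_of_le_inv₀ ha ((smul_one_le_iff_le_spectrum hS.isHermitian).1 h _
    (inv_mem_spectrum_of_mem_spectrum_inv hS.isUnit hx))

lemma inv_smul_one_le_inv (hS : S.PosDef) (h : S ≤ b • 1) : b⁻¹ • 1 ≤ S⁻¹ := by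
  refine (smul_one_le_iff_le_spectrum hS.inv.isHermitian).2 fun x hx => ?_
  have hx₀ : 0 < x := hS.inv.isStrictlyPositive.spectrum_pos hx
  exact inv_le_of_inv_le₀ hx₀ ((le_smul_one_iff_spectrum_le hS.isHermitian).1 h _
    (inv_mem_spectrum_of_mem_spectrum_inv hS.isUnit hx))

lemma mul_dotProduct_self_le (h : a • 1 ≤ S) (v : n → ℝ) : a * (v ⬝ᵥ v) ≤ v ⬝ᵥ S *ᵥ v := by
  simpa only [smul_mulVec, one_mulVec, dotProduct_smul, smul_eq_mul]
    using dotProduct_mulVec_mono h v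

lemma dotProduct_mulVec_le (h : S ≤ b • 1) (v : n → ℝ) : v ⬝ᵥ S *ᵥ v ≤ b * (v ⬝ᵥ v) := by
  simpa only [smul_mulVec, one_mulVec, dotProduct_smul, smul_eq_mul]
    using dotProduct_mulVec_mono h v

lemma abs_dotProduct_mulVec_le (hS : S.PosSemidef) (h : S ≤ b • 1) (v w : n → ℝ) :
    |v ⬝ᵥ S *ᵥ w| ≤ b * (v ⬝ᵥ v + w ⬝ᵥ w) / 2 := by
  have hsymm : w ⬝ᵥ S *ᵥ v = v ⬝ᵥ S *ᵥ w := by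
    rw [dotProduct_mulVec, ← mulVec_transpose, dotProduct_comm,
      ← conjTranspose_eq_transpose_of_trivial, hS.isHermitian.eq]
  have hadd := hS.dotProduct_mulVec_nonneg (v + w)
  have hsub := hS.dotProduct_mulVec_nonneg (v - w)
  have hv := dotProduct_mulVec_le h v
  have hw := dotProduct_mulVec_le h w
  simp only [star_trivial, mulVec_add, mulVec_sub, add_dotProduct, sub_dotProduct, dotProduct_add,
    dotProduct_sub, hsymm] at hadd hsub
  rw [abs_le]
  constructor <;> linarith

end LoewnerOrder

section Concentration

open ProbabilityTheory

variable {E : Type*} [MeasurableSpace E] (ρ : Measure E) [IsProbabilityMeasure ρ] {m : ℕ}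

lemma hasSubgaussianMGF_eval_sub_integral {g : E → ℝ} (hg : Measurable g) {b : ℝ}
    (hb : ∀ x, |g x| ≤ b) (j : Fin m) :
    HasSubgaussianMGF (fun x : Fin m → E => g (x j) - ∫ y, g y ∂ρ) (‖b‖₊ ^ 2)
      (Measure.pi fun _ => ρ) := by
  have hmap : (Measure.pi fun _ : Fin m => ρ).map (fun x => x j) = ρ :=
    (measurePreserving_eval (fun _ : Fin m => ρ) j).map_eq
  have hcoord := hasSubgaussianMGF_of_mem_Icc (μ := ρ) (a := -b) (b := b) hg.aemeasurable
    (.of_forall fun x => abs_le.1 (hb x))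
  have hconst : (‖b - -b‖₊ / 2) ^ 2 = ‖b‖₊ ^ 2 := by
    rw [sub_neg_eq_add, ← two_mul, nnnorm_mul, Real.nnnorm_two, mul_div_cancel_left₀ _ two_ne_zero]
  rw [hconst, ← hmap] at hcoord
  have hpull := hcoord.of_map (Y := fun x : Fin m → E => x j) (measurable_pi_apply j).aemeasurable
  rwa [hmap] at hpull

lemma measureReal_pi_le_sum_sub_integral {g : E → ℝ} (hg : Measurable g) {b s : ℝ}
    (hb : ∀ x, |g x| ≤ b) (hs : 0 ≤ s) :
    (Measure.pi fun _ : Fin m => ρ).real {x | s ≤ ∑ j, (g (x j) - ∫ y, g y ∂ρ)} ≤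
      Real.exp (-s ^ 2 / (2 * (m * b ^ 2))) := by
  have hindep : iIndepFun (fun (j : Fin m) (x : Fin m → E) => g (x j) - ∫ y, g y ∂ρ)
      (Measure.pi fun _ => ρ) :=
    iIndepFun_pi (X := fun _ y => g y - ∫ y, g y ∂ρ) fun _ => (hg.sub_const _).aemeasurable
  simpa using HasSubgaussianMGF.measure_sum_ge_le_of_iIndepFun hindep (s := Finset.univ)
    (fun j _ => hasSubgaussianMGF_eval_sub_integral ρ hg hb j) hs

lemma measureReal_pi_le_abs_integral_sub_mean (hm : 0 < m) {g : E → ℝ} (hg : Measurable g)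
    {b t : ℝ} (hb : ∀ x, |g x| ≤ b) (ht : 0 ≤ t) :
    (Measure.pi fun _ : Fin m => ρ).real {x | t ≤ |∫ y, g y ∂ρ - (m : ℝ)⁻¹ * ∑ j, g (x j)|} ≤
      2 * Real.exp (-(m * t ^ 2) / (2 * b ^ 2)) := by
  have hm' : (0 : ℝ) < m := by exact_mod_cast hm
  have hupper := measureReal_pi_le_sum_sub_integral ρ (m := m) hg hb (s := m * t) (by positivity)
  have hlower := measureReal_pi_le_sum_sub_integral ρ (m := m) hg.neg (b := b) (s := m * t)
    (by simpa using hb) (by positivity)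
  have hexponent : -(m * t) ^ 2 / (2 * (m * b ^ 2)) = -(m * t ^ 2) / (2 * b ^ 2) := by
    rw [← mul_div_mul_left (-(m * t ^ 2)) (2 * b ^ 2) hm'.ne']
    ring_nf
  have hsub : {x : Fin m → E | t ≤ |∫ y, g y ∂ρ - (m : ℝ)⁻¹ * ∑ j, g (x j)|} ⊆
      {x | m * t ≤ ∑ j, (g (x j) - ∫ y, g y ∂ρ)} ∪
        {x | m * t ≤ ∑ j, ((-g) (x j) - ∫ y, (-g) y ∂ρ)} := by
    intro x hx
    have hsum : ∑ j, (g (x j) - ∫ y, g y ∂ρ) = m * ((m : ℝ)⁻¹ * ∑ j, g (x j) - ∫ y, g y ∂ρ) := by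
      rw [Finset.sum_sub_distrib, Finset.sum_const, Finset.card_univ, Fintype.card_fin,
        nsmul_eq_mul]
      field_simp
    have hneg : ∑ j, ((-g) (x j) - ∫ y, (-g) y ∂ρ) = -∑ j, (g (x j) - ∫ y, g y ∂ρ) := by
      rw [← Finset.sum_neg_distrib]
      simp only [Pi.neg_apply, integral_neg, neg_sub_neg, neg_sub]
    rw [Set.mem_union, Set.mem_ofPred_eq, Set.mem_ofPred_eq, hneg, hsum, ← mul_neg,
      mul_le_mul_iff_right₀ hm', mul_le_mul_iff_right₀ hm', ← le_abs, abs_sub_comm]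
    exact hx
  rw [hexponent] at hupper hlower
  calc _ ≤ _ := measureReal_mono hsub
    _ ≤ _ := measureReal_union_le _ _
    _ ≤ _ := add_le_add hupper hlower
    _ = _ := (two_mul _).symm

lemma measure_pi_exists_lt_abs_integral_sub_mean_le (hm : 0 < m) {ι : Type*} [Fintype ι]
    {g : ι → E → ℝ} (hg : ∀ i, Measurable (g i)) {b δ L : ℝ} (hb : 0 < b)
    (hgb : ∀ i x, |g i x| ≤ b) (hL : 0 ≤ L) (hcard : 2 * Fintype.card ι ≤ δ * Real.exp L) :
    (Measure.pi fun _ : Fin m => ρ) {x | ∃ i,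
        b * √(2 * L / m) < |∫ y, g i y ∂ρ - (m : ℝ)⁻¹ * ∑ j, g i (x j)|} ≤
      ENNReal.ofReal δ := by
  have : (0 : ℝ) < m := by exact_mod_cast hm
  have hsingle (i : ι) : (Measure.pi fun _ : Fin m => ρ).real
      {x | b * √(2 * L / m) ≤ |∫ y, g i y ∂ρ - (m : ℝ)⁻¹ * ∑ j, g i (x j)|} ≤
      2 * Real.exp (-L) := by
    refine (measureReal_pi_le_abs_integral_sub_mean ρ hm (hg i) (hgb i) (by positivity)).trans_eq ?_
    congr 2
    rw [mul_pow, Real.sq_sqrt (by positivity)]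
    field_simp
  have hsub : {x : Fin m → E | ∃ i,
        b * √(2 * L / m) < |∫ y, g i y ∂ρ - (m : ℝ)⁻¹ * ∑ j, g i (x j)|} ⊆
      ⋃ i ∈ Finset.univ,
        {x | b * √(2 * L / m) ≤ |∫ y, g i y ∂ρ - (m : ℝ)⁻¹ * ∑ j, g i (x j)|} :=
    fun x ⟨i, hi⟩ => Set.mem_biUnion (Finset.mem_coe.2 (Finset.mem_univ i)) hi.le
  rw [← ofReal_measureReal]
  refine ENNReal.ofReal_le_ofReal ?_
  calc _ ≤ _ := measureReal_mono hsub (measure_ne_top _ _)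
    _ ≤ ∑ i, _ := measureReal_biUnion_finset_le _ _
    _ ≤ ∑ _i : ι, 2 * Real.exp (-L) := Finset.sum_le_sum fun i _ => hsingle i
    _ = 2 * Fintype.card ι * Real.exp (-L) := by
      rw [Finset.sum_const, nsmul_eq_mul, Finset.card_univ]; ring
    _ ≤ δ * Real.exp L * Real.exp (-L) := by gcongr
    _ = δ := by rw [mul_assoc, ← Real.exp_add, add_neg_cancel, Real.exp_zero, mul_one]

lemma measure_pi_exists_mem_le {s : Set E} (hs : MeasurableSet s) :
    (Measure.pi fun _ : Fin m => ρ) {x | ∃ j, x j ∈ s} ≤ ENNReal.ofReal (m * ρ.real s) := by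
  have hiUnion : {x : Fin m → E | ∃ j, x j ∈ s} = ⋃ j, (fun x : Fin m → E => x j) ⁻¹' s := by
    ext x; simp
  rw [hiUnion]
  calc _ ≤ ∑ j, (Measure.pi fun _ : Fin m => ρ) ((fun x => x j) ⁻¹' s) :=
        measure_iUnion_fintype_le _ _
    _ = ∑ _j : Fin m, ρ s := Finset.sum_congr rfl fun j _ =>
        (measurePreserving_eval (fun _ : Fin m => ρ) j).measure_preimage hs.nullMeasurableSet
    _ = _ := by
      rw [Finset.sum_const, nsmul_eq_mul, Finset.card_univ, Fintype.card_fin,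
        ENNReal.ofReal_mul (Nat.cast_nonneg _), ENNReal.ofReal_natCast, ofReal_measureReal]

end Concentration

section EmpiricalMeasure

variable {d m : ℕ}

lemma integral_empiricalMeasure (x : Fin m → EuclideanSpace ℝ (Fin d))
    (f : EuclideanSpace ℝ (Fin d) → ℝ) :
    ∫ y, f y ∂(empiricalMeasure x) = (m : ℝ)⁻¹ * ∑ j, f (x j) := by
  rw [empiricalMeasure, integral_smul_measure,
    integral_finsetSum_measure fun j _ => integrable_dirac (by simp)]
  simp

lemma isProbabilityMeasure_empiricalMeasure (hm : 0 < m)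
    (x : Fin m → EuclideanSpace ℝ (Fin d)) : IsProbabilityMeasure (empiricalMeasure x) := by
  constructor
  simp only [empiricalMeasure, Measure.smul_apply, Measure.coe_finsetSum, Finset.sum_apply,
    measure_univ, Finset.sum_const, Finset.card_univ, Fintype.card_fin, nsmul_eq_mul, mul_one,
    smul_eq_mul]
  exact ENNReal.inv_mul_cancel (by simpa using hm.ne') (by simp)

lemma integral_indicator_one_sub_half {E : Type*} [MeasurableSpace E] (ν : Measure E)
    [IsProbabilityMeasure ν] {s : Set E} (hs : MeasurableSet s) :
    ∫ y, (s.indicator 1 y - 1 / 2 : ℝ) ∂ν = ν.real s - 1 / 2 := by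
  have hint : Integrable (s.indicator (1 : E → ℝ)) ν := (integrable_const (1 : ℝ)).indicator hs
  rw [integral_sub hint (integrable_const _), integral_indicator_one hs,
    integral_const, probReal_univ, one_smul]

lemma measure_pi_empiricalMeasure_lt_half_le (hm : 0 < m)
    (ρ : Measure (EuclideanSpace ℝ (Fin d))) [IsProbabilityMeasure ρ]
    {B : Set (EuclideanSpace ℝ (Fin d))} (hB : MeasurableSet B) (hρB : 3 / 4 ≤ ρ.real B)
    {δ : ℝ} (hδ : 0 < δ) (hmδ : 8 * Real.log (1 / δ) ≤ m) :
    (Measure.pi fun _ : Fin m => ρ) {x | (empiricalMeasure x).real B < 1 / 2} ≤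
      ENNReal.ofReal (2 * δ) := by
  let g : EuclideanSpace ℝ (Fin d) → ℝ := fun y => B.indicator 1 y - 1 / 2
  have hg : Measurable g := (measurable_one.indicator hB).sub_const _
  have hgb (y) : |g y| ≤ 1 / 2 := by
    by_cases hy : y ∈ B <;> norm_num [g, hy, abs_le]
  have hsub : {x : Fin m → EuclideanSpace ℝ (Fin d) | (empiricalMeasure x).real B < 1 / 2} ⊆
      {x | 1 / 4 ≤ |∫ y, g y ∂ρ - (m : ℝ)⁻¹ * ∑ j, g (x j)|} := by
    intro x hx
    have := isProbabilityMeasure_empiricalMeasure hm x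
    rw [Set.mem_ofPred_eq, ← integral_empiricalMeasure, integral_indicator_one_sub_half ρ hB,
      integral_indicator_one_sub_half _ hB]
    refine le_abs.2 (.inl ?_)
    linarith [Set.mem_ofPred.1 hx]
  have hexp : Real.exp (-(m * (1 / 4) ^ 2) / (2 * (1 / 2) ^ 2)) ≤ δ := by
    rw [← Real.le_log_iff_exp_le hδ,
      show -(m * (1 / 4) ^ 2) / (2 * (1 / 2) ^ 2) = -((m : ℝ) / 8) by ring]
    rw [one_div, Real.log_inv] at hmδ
    linarith
  rw [← ofReal_measureReal]
  refine ENNReal.ofReal_le_ofReal ?_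
  calc _ ≤ _ := measureReal_mono hsub (measure_ne_top _ _)
    _ ≤ _ := measureReal_pi_le_abs_integral_sub_mean ρ hm hg hgb (by norm_num)
    _ ≤ 2 * δ := by gcongr

end EmpiricalMeasure

section Moments

variable {d : ℕ} {ρ : Measure (EuclideanSpace ℝ (Fin d))} {p : ℕ} {M : ℝ}

lemma HasMomentBound.nonneg (h : HasMomentBound ρ p M) (hp : 1 ≤ p) : 0 ≤ M :=
  (integral_nonneg fun x => by positivity).trans (h 1 le_rfl hp).2

lemma HasMomentBound.pow_mul_measureReal_compl_closedBall_le [IsFiniteMeasure ρ]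
    (h : HasMomentBound ρ p M) {l : ℕ} (hl : 1 ≤ l) (hlp : l ≤ p) {R : ℝ} (hR : 0 ≤ R) :
    R ^ l * ρ.real (Metric.closedBall (∫ y, y ∂ρ) R)ᶜ ≤ M := by
  obtain ⟨hint, hM⟩ := h l hl hlp
  refine le_trans ?_ ((mul_meas_ge_le_integral_of_nonneg (.of_forall fun x => by positivity)
    hint (R ^ l)).trans hM)
  gcongr ?_ * ?_
  refine measureReal_mono (fun x hx => ?_) (measure_ne_top _ _)
  have hRx : R < ‖x - ∫ y, y ∂ρ‖ := by simpa [dist_eq_norm] using hx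
  exact pow_le_pow_left₀ hR hRx.le l

lemma HasMomentBound.integrable_of_abs_le [IsFiniteMeasure ρ] (h : HasMomentBound ρ p M)
    (hp : 2 ≤ p) {f : EuclideanSpace ℝ (Fin d) → ℝ} (hf : Measurable f) {A : ℝ}
    (hfA : ∀ x, |f x| ≤ A * (1 + ‖x - ∫ y, y ∂ρ‖ ^ 2)) : Integrable f ρ :=
  (((integrable_const (1 : ℝ)).add (h 2 one_le_two hp).1).const_mul A).mono'
    hf.aestronglyMeasurable (.of_forall hfA)

lemma one_add_sq_le_pow_div {r R : ℝ} (hR : 1 ≤ R) (hr : R ≤ r) (hp : 2 ≤ p) :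
    1 + r ^ 2 ≤ 2 / R ^ (p - 2) * r ^ p := by
  have hr₁ : 1 ≤ r := hR.trans hr
  calc 1 + r ^ 2 ≤ 2 * r ^ 2 := by nlinarith
    _ ≤ 2 * r ^ 2 * (r ^ (p - 2) / R ^ (p - 2)) :=
      le_mul_of_one_le_right (by positivity) ((one_le_div (by positivity)).2 (by gcongr))
    _ = 2 / R ^ (p - 2) * r ^ p := by rw [← pow_sub_mul_pow r hp]; ring

lemma HasMomentBound.abs_setIntegral_compl_closedBall_le (h : HasMomentBound ρ p M) (hp : 2 ≤ p)
    {f : EuclideanSpace ℝ (Fin d) → ℝ} {A R : ℝ} (hA : 0 ≤ A) (hR : 1 ≤ R)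
    (hfA : ∀ x, |f x| ≤ A * (1 + ‖x - ∫ y, y ∂ρ‖ ^ 2)) :
    |∫ x in (Metric.closedBall (∫ y, y ∂ρ) R)ᶜ, f x ∂ρ| ≤ 2 * A * M / R ^ (p - 2) := by
  set x₀ := ∫ y, y ∂ρ
  obtain ⟨hint, hM⟩ := h p (one_le_two.trans hp) le_rfl
  have hint' : Integrable (fun x => A * (2 / R ^ (p - 2) * ‖x - x₀‖ ^ p)) ρ :=
    (hint.const_mul _).const_mul _
  have hpt : ∀ x ∈ (Metric.closedBall x₀ R)ᶜ, ‖f x‖ ≤ A * (2 / R ^ (p - 2) * ‖x - x₀‖ ^ p) := by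
    intro x hx
    have hRx : R < ‖x - x₀‖ := by simpa [dist_eq_norm] using hx
    exact (hfA x).trans (by gcongr; exact one_add_sq_le_pow_div hR hRx.le hp)
  calc _ ≤ ∫ x in (Metric.closedBall x₀ R)ᶜ, A * (2 / R ^ (p - 2) * ‖x - x₀‖ ^ p) ∂ρ :=
        norm_integral_le_of_norm_le hint'.integrableOn
          ((ae_restrict_iff' measurableSet_closedBall.compl).2 (.of_forall hpt))
    _ ≤ ∫ x, A * (2 / R ^ (p - 2) * ‖x - x₀‖ ^ p) ∂ρ :=
        setIntegral_le_integral hint' (.of_forall fun x => by positivity)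
    _ = A * (2 / R ^ (p - 2) * ∫ x, ‖x - x₀‖ ^ p ∂ρ) := by
        rw [integral_const_mul, integral_const_mul]
    _ ≤ A * (2 / R ^ (p - 2) * M) := by gcongr
    _ = _ := by ring

end Moments

section FiniteNets

variable {E : Type*} [MeasurableSpace E] (ρ : Measure E) [IsProbabilityMeasure ρ] {m : ℕ}

lemma abs_setIntegral_sub_mean_le_add (hm : 0 < m) {B : Set E}
    {x : Fin m → E} (hx : ∀ j, x j ∈ B) {f g : E → ℝ} (hf : IntegrableOn f B ρ)
    (hg : IntegrableOn g B ρ) {ε : ℝ} (hfg : ∀ y ∈ B, |f y - g y| ≤ ε) :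
    |∫ y in B, f y ∂ρ - (m : ℝ)⁻¹ * ∑ j, f (x j)| ≤
      |∫ y in B, g y ∂ρ - (m : ℝ)⁻¹ * ∑ j, g (x j)| + 2 * ε := by
  have hm' : (0 : ℝ) < m := by exact_mod_cast hm
  have hε : 0 ≤ ε := (abs_nonneg _).trans (hfg _ (hx ⟨0, hm⟩))
  have hintegral : |∫ y in B, f y ∂ρ - ∫ y in B, g y ∂ρ| ≤ ε := by
    rw [← integral_sub hf hg]
    exact (norm_setIntegral_le_of_norm_le_const (f := fun y => f y - g y) (measure_lt_top _ _)
      hfg).trans (mul_le_of_le_one_right hε measureReal_le_one)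
  have hmean : |(m : ℝ)⁻¹ * ∑ j, f (x j) - (m : ℝ)⁻¹ * ∑ j, g (x j)| ≤ ε := by
    rw [← mul_sub, ← Finset.sum_sub_distrib, abs_mul, abs_of_pos (inv_pos.2 hm'),
      inv_mul_le_iff₀ hm']
    calc |∑ j, (f (x j) - g (x j))| ≤ ∑ j, |f (x j) - g (x j)| := Finset.abs_sum_le_sum_abs _ _
      _ ≤ ∑ _j : Fin m, ε := Finset.sum_le_sum fun j _ => hfg _ (hx j)
      _ = m * ε := by rw [Finset.sum_const, Finset.card_univ, Fintype.card_fin, nsmul_eq_mul]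
  rw [abs_le] at hintegral hmean
  have hle := le_abs_self (∫ y in B, g y ∂ρ - (m : ℝ)⁻¹ * ∑ j, g (x j))
  have hge := neg_abs_le (∫ y in B, g y ∂ρ - (m : ℝ)⁻¹ * ∑ j, g (x j))
  exact abs_le.2 ⟨by linarith, by linarith⟩

lemma measure_pi_exists_approx_lt_abs_le (hm : 0 < m) {ι : Type*} [Fintype ι] {h : ι → E → ℝ}
    (hh : ∀ i, Measurable (h i)) {B : Set E} (hB : MeasurableSet B) {b δ L ε : ℝ} (hb : 0 < b)
    (hL : 0 ≤ L) (hcard : 2 * Fintype.card ι ≤ δ * Real.exp L) :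
    (Measure.pi fun _ : Fin m => ρ) {x | (∀ j, x j ∈ B) ∧ ∃ f : E → ℝ, Measurable f ∧
        (∀ y ∈ B, |f y| ≤ b) ∧ (∃ i, ∀ y ∈ B, |f y - h i y| ≤ ε) ∧
        b * √(2 * L / m) + 2 * ε < |∫ y in B, f y ∂ρ - (m : ℝ)⁻¹ * ∑ j, f (x j)|} ≤
      ENNReal.ofReal δ := by
  have hbb : -b ≤ b := by linarith
  let clipped (i : ι) (y : E) : ℝ := Set.projIcc (-b) b hbb (h i y)
  have hmeas (i : ι) : Measurable (clipped i) :=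
    measurable_subtype_coe.comp (continuous_projIcc.measurable.comp (hh i))
  have hbound (i : ι) (y : E) : |clipped i y| ≤ b := abs_le.2 (Set.projIcc (-b) b hbb (h i y)).2
  have hintOn {g : E → ℝ} (hg : Measurable g) (hgb : ∀ y ∈ B, |g y| ≤ b) : IntegrableOn g B ρ :=
    .of_bound (measure_lt_top _ _) hg.aestronglyMeasurable b
      ((ae_restrict_iff' hB).2 (.of_forall hgb))
  refine (measure_mono fun x hx => ?_).trans
    (measure_pi_exists_lt_abs_integral_sub_mean_le ρ hm (fun i => (hmeas i).indicator hB)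
      hb (fun i y => ?_) hL hcard)
  · obtain ⟨hxB, f, hf, hfb, ⟨i, hfi⟩, hdev⟩ := hx
    have hclip : ∀ y ∈ B, |f y - clipped i y| ≤ ε := fun y hy => by
      have hproj : (Set.projIcc (-b) b hbb (f y) : ℝ) = f y :=
        congrArg Subtype.val (Set.projIcc_of_mem hbb (abs_le.1 (hfb y hy)))
      calc |f y - clipped i y| = |(Set.projIcc (-b) b hbb (f y) : ℝ) - clipped i y| := by rw [hproj]
        _ ≤ |f y - h i y| := Set.abs_projIcc_sub_projIcc hbb
        _ ≤ ε := hfi y hy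
    have htransfer := abs_setIntegral_sub_mean_le_add ρ hm hxB (hintOn hf hfb)
      (hintOn (hmeas i) fun y _ => hbound i y) hclip
    refine ⟨i, ?_⟩
    simp only [integral_indicator hB, Set.indicator_of_mem (hxB _)]
    linarith
  · by_cases hy : y ∈ B
    · rw [Set.indicator_of_mem hy]; exact hbound i y
    · rw [Set.indicator_of_notMem hy, abs_zero]; exact hb.le

end FiniteNets

section LogSumExp

lemma abs_log_sum_exp_sub_le {ι : Type*} [Fintype ι] {u v : ι → ℝ} {ε : ℝ} (hε : 0 ≤ ε)
    (h : ∀ i, |u i - v i| ≤ ε) :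
    |Real.log (∑ i, Real.exp (u i)) - Real.log (∑ i, Real.exp (v i))| ≤ ε := by
  rcases isEmpty_or_nonempty ι
  · simpa using hε
  have key (u v : ι → ℝ) (huv : ∀ i, u i ≤ v i + ε) :
      Real.log (∑ i, Real.exp (u i)) ≤ Real.log (∑ i, Real.exp (v i)) + ε := by
    have hpos (u : ι → ℝ) : 0 < ∑ i, Real.exp (u i) :=
      Finset.sum_pos (fun i _ => Real.exp_pos _) Finset.univ_nonempty
    rw [← Real.log_exp ε, ← Real.log_mul (hpos v).ne' (Real.exp_pos _).ne', Finset.sum_mul]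
    refine Real.log_le_log (hpos u) (Finset.sum_le_sum fun i _ => ?_)
    rw [← Real.exp_add]
    exact Real.exp_le_exp.2 (huv i)
  have huv := key u v fun i => by linarith [(abs_le.1 (h i)).2]
  have hvu := key v u fun i => by linarith [(abs_le.1 (h i)).1]
  exact abs_le.2 ⟨by linarith, by linarith⟩

lemma exists_int_mem_Icc_abs_sub_mul_le {η w : ℝ} (hη : 0 < η) {J : ℕ} (hw : |w| ≤ J * η) :
    ∃ z ∈ Finset.Icc (-J : ℤ) J, |w - z * η| ≤ η := by
  obtain ⟨hlo, hhi⟩ := abs_le.1 hw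
  refine ⟨⌊w / η⌋, Finset.mem_Icc.2 ⟨?_, ?_⟩, ?_⟩
  · rw [Int.le_floor, le_div_iff₀ hη]
    push_cast
    linarith
  · have : w / η ≤ (J : ℤ) := by rw [div_le_iff₀ hη]; exact_mod_cast hhi
    exact_mod_cast (Int.floor_le _).trans this
  · have hfloor := (le_div_iff₀ hη).1 (Int.floor_le (w / η))
    have hlt := (div_lt_iff₀ hη).1 (Int.lt_floor_add_one (w / η))
    exact abs_le.2 ⟨by linarith, by linarith⟩

variable {E ι : Type*} [Fintype ι] {k : ℕ} {φ : ι → E → ℝ}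

/-- The log-sum-exp of `k` linear combinations of the features `φ`, with coefficients `w`.  A
Gaussian mixture score has this form for suitable quadratic features. -/
noncomputable def logSumExpFeatures (φ : ι → E → ℝ) (w : Fin k → ι → ℝ) (x : E) : ℝ :=
  Real.log (∑ i, Real.exp (∑ s, w i s * φ s x))

lemma measurable_logSumExpFeatures [MeasurableSpace E] (hφ : ∀ s, Measurable (φ s))
    (w : Fin k → ι → ℝ) : Measurable (logSumExpFeatures φ w) := by
  unfold logSumExpFeatures
  fun_prop

lemma abs_logSumExpFeatures_sub_le {w w' : Fin k → ι → ℝ} {η Φ : ℝ} (hη : 0 ≤ η) (hΦ : 0 ≤ Φ)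
    (hw : ∀ i s, |w i s - w' i s| ≤ η) {x : E} (hφ : ∀ s, |φ s x| ≤ Φ) :
    |logSumExpFeatures φ w x - logSumExpFeatures φ w' x| ≤ Fintype.card ι * (η * Φ) := by
  refine abs_log_sum_exp_sub_le (by positivity) fun i => ?_
  rw [← Finset.sum_sub_distrib]
  calc |∑ s, (w i s * φ s x - w' i s * φ s x)|
      ≤ ∑ s, |w i s * φ s x - w' i s * φ s x| := Finset.abs_sum_le_sum_abs _ _
    _ ≤ ∑ _s : ι, η * Φ := Finset.sum_le_sum fun s _ => by
      rw [← sub_mul, abs_mul]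
      gcongr
      exacts [hw i s, hφ s]
    _ = Fintype.card ι * (η * Φ) := by rw [Finset.sum_const, nsmul_eq_mul, Finset.card_univ]

lemma measure_pi_exists_logSumExpFeatures_lt_abs_le [MeasurableSpace E] (ρ : Measure E)
    [IsProbabilityMeasure ρ] {m : ℕ} (hm : 0 < m) (k : ℕ) (hφ : ∀ s, Measurable (φ s)) {B : Set E}
    (hB : MeasurableSet B) {Φ : ℝ} (hΦ : 0 ≤ Φ) (hφB : ∀ x ∈ B, ∀ s, |φ s x| ≤ Φ)
    {b η δ L ε : ℝ} (hb : 0 < b) (hη : 0 < η) (J : ℕ) (hL : 0 ≤ L)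
    (hcard : 2 * (2 * (J : ℝ) + 1) ^ (k * Fintype.card ι) ≤ δ * Real.exp L) :
    (Measure.pi fun _ : Fin m => ρ) {x | (∀ j, x j ∈ B) ∧ ∃ f : E → ℝ, Measurable f ∧
        (∀ y ∈ B, |f y| ≤ b) ∧
        (∃ w : Fin k → ι → ℝ, (∀ i s, |w i s| ≤ J * η) ∧
          ∀ y ∈ B, |f y - logSumExpFeatures φ w y| ≤ ε) ∧
        b * √(2 * L / m) + 2 * (ε + Fintype.card ι * (η * Φ)) <
          |∫ y in B, f y ∂ρ - (m : ℝ)⁻¹ * ∑ j, f (x j)|} ≤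
      ENNReal.ofReal δ := by
  classical
  let net (q : Fin k → ι → Finset.Icc (-J : ℤ) J) : E → ℝ :=
    logSumExpFeatures φ fun i s => (q i s : ℤ) * η
  have hnet : 2 * (Fintype.card (Fin k → ι → Finset.Icc (-J : ℤ) J) : ℝ) ≤ δ * Real.exp L := by
    have hIcc : (Finset.Icc (-J : ℤ) J).card = 2 * J + 1 := by rw [Int.card_Icc]; omega
    rw [Fintype.card_fun, Fintype.card_fun, Fintype.card_coe, hIcc, Fintype.card_fin, ← pow_mul,
      mul_comm _ k]
    exact_mod_cast hcard
  refine (measure_mono fun x hx => ?_).trans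
    (measure_pi_exists_approx_lt_abs_le ρ hm (h := net)
      (ε := ε + Fintype.card ι * (η * Φ))
      (fun q => measurable_logSumExpFeatures hφ _) hB hb hL hnet)
  obtain ⟨hxB, f, hf, hfb, ⟨w, hw, hfw⟩, hdev⟩ := hx
  choose z hz hzw using fun i s => exists_int_mem_Icc_abs_sub_mul_le hη (hw i s)
  refine ⟨hxB, f, hf, hfb, ⟨fun i s => ⟨z i s, hz i s⟩, fun y hy => ?_⟩, hdev⟩
  exact (abs_sub_le _ _ _).trans
    (add_le_add (hfw y hy) (abs_logSumExpFeatures_sub_le hη.le hΦ hzw (hφB y hy)))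

end LogSumExp

section GaussianLogDensity

open Matrix
open scoped MatrixOrder

variable {d : ℕ}

lemma dotProduct_ofLp_self (v : EuclideanSpace ℝ (Fin d)) : v.ofLp ⬝ᵥ v.ofLp = ‖v‖ ^ 2 := by
  rw [EuclideanSpace.real_norm_sq_eq]
  simp only [dotProduct, ← pow_two]

/-- The logarithm of the normalizing constant of the Gaussian density with covariance `S`. -/
noncomputable def gaussianLogNormalizer (S : Matrix (Fin d) (Fin d) ℝ) : ℝ :=
  -(1 / 2) * Real.log ((2 * Real.pi) ^ d * S.det)

lemma gaussianDensity_eq_exp {S : Matrix (Fin d) (Fin d) ℝ} (hS : 0 < S.det)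
    (μ x : EuclideanSpace ℝ (Fin d)) :
    gaussianDensity μ S x = Real.exp (gaussianLogNormalizer S -
      1 / 2 * ((x - μ).ofLp ⬝ᵥ S⁻¹ *ᵥ (x - μ).ofLp)) := by
  have hpos : 0 < (2 * Real.pi) ^ d * S.det := by positivity
  have hexp : Real.exp (gaussianLogNormalizer S) = 1 / √((2 * Real.pi) ^ d * S.det) := by
    rw [gaussianLogNormalizer, neg_mul, Real.exp_neg, one_div_mul_eq_div,
      ← Real.log_sqrt hpos.le, Real.exp_log (Real.sqrt_pos.2 hpos), one_div]
  rw [gaussianDensity, ← hexp, ← Real.exp_add, neg_mul, ← sub_eq_add_neg]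

lemma continuous_gaussianDensity (μ : EuclideanSpace ℝ (Fin d)) (S : Matrix (Fin d) (Fin d) ℝ) :
    Continuous (gaussianDensity μ S) := by
  unfold gaussianDensity
  simp only [dotProduct, mulVec]
  fun_prop

lemma abs_gaussianLogNormalizer_le {S : Matrix (Fin d) (Fin d) ℝ} {Q : ℝ} (hQ : 0 < Q)
    (hS : Q⁻¹ • 1 ≤ S) (hS' : S ≤ Q • 1) :
    |gaussianLogNormalizer S| ≤ d / 2 * (1 + Q) := by
  have hpos := posDef_of_smul_one_le (inv_pos.2 hQ) hS
  have hlog_le := Real.log_le_log hpos.det_pos (det_le_pow_card hpos.posSemidef hS')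
  have hle_log := Real.log_le_log (by positivity) (pow_card_le_det (inv_pos.2 hQ).le hS)
  rw [Fintype.card_fin, Real.log_pow] at hlog_le hle_log
  rw [Real.log_inv] at hle_log
  have hlogQ := mul_le_mul_of_nonneg_left (Real.log_le_sub_one_of_pos hQ) d.cast_nonneg
  have hpi_pos : 0 ≤ Real.log (2 * Real.pi) := Real.log_nonneg (by linarith [Real.pi_gt_three])
  have hpi_le : Real.log (2 * Real.pi) ≤ 2 := by
    rw [Real.log_le_iff_le_exp (by positivity), show (2 : ℝ) = 1 + 1 by norm_num, Real.exp_add]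
    nlinarith [Real.pi_lt_d2, Real.exp_one_gt_d9]
  have hpi := mul_le_mul_of_nonneg_left hpi_le (d.cast_nonneg (α := ℝ))
  have hpi' := mul_nonneg (d.cast_nonneg (α := ℝ)) hpi_pos
  rw [gaussianLogNormalizer, Real.log_mul (by positivity) hpos.det_pos.ne', Real.log_pow, abs_le]
  constructor <;> linarith

end GaussianLogDensity

section ControlledMixtures

lemma norm_sub_sq_le_two_mul_add {E : Type*} [SeminormedAddCommGroup E] (x y z : E) :
    ‖x - z‖ ^ 2 ≤ 2 * ‖x - y‖ ^ 2 + 2 * ‖y - z‖ ^ 2 := by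
  have hsq := pow_le_pow_left₀ (norm_nonneg _) (norm_sub_le_norm_sub_add_norm_sub x y z) 2
  linarith [add_sq_le (a := ‖x - y‖) (b := ‖y - z‖)]

open Matrix
open scoped MatrixOrder

namespace MixtureParams

variable {d : ℕ}

/-- The weighted density `αᵢ p_{μᵢ, Σᵢ}` of the `i`-th component. -/
noncomputable def component (θ : MixtureParams d) (i : Fin θ.size)
    (x : EuclideanSpace ℝ (Fin d)) : ℝ :=
  θ.weight i * gaussianDensity (θ.mean i) (θ.cov i) x

/-- The logarithm of the `i`-th weight times the normalizing constant of the `i`-th density. -/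
noncomputable def logScale (θ : MixtureParams d) (i : Fin θ.size) : ℝ :=
  Real.log (θ.weight i) + gaussianLogNormalizer (θ.cov i)

lemma measurable_mixtureScore (θ : MixtureParams d) : Measurable (mixtureScore θ) := by
  unfold mixtureScore
  exact Real.measurable_log.comp (Continuous.measurable (continuous_finsetSum _ fun i _ =>
    (continuous_gaussianDensity _ _).const_mul _))

/-- The constraints on mixture parameters that are independent of the measure, with all bounds
expressed by a single constant `Q`. -/
structure IsControlled (θ : MixtureParams d) (Q : ℝ) : Prop where
  dim_add_one_le : (d : ℝ) + 1 ≤ Q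
  size_le : (θ.size : ℝ) ≤ Q
  weight_nonneg : ∀ i, 0 ≤ θ.weight i
  sum_weight : ∑ i, θ.weight i = 1
  inv_smul_one_le_cov : ∀ i, Q⁻¹ • 1 ≤ θ.cov i
  cov_le_smul_one : ∀ i, θ.cov i ≤ Q • 1

lemma isControlled_of_mem_mogClass {θ : MixtureParams d} {ν : Measure (EuclideanSpace ℝ (Fin d))}
    {c σ₁ σ₂ Q : ℝ} {k : ℕ} (hθ : θ ∈ mogClass ν c k σ₁ σ₂) (hσ₁ : 0 < σ₁) (hd : (d : ℝ) + 1 ≤ Q)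
    (hk : (k : ℝ) ≤ Q) (hσ₁Q : 1 / σ₁ ≤ Q) (hσ₂Q : σ₂ ≤ Q) : θ.IsControlled Q := by
  obtain ⟨hsize, hw, hsum, hcov, -, -⟩ := hθ
  have hone : (0 : Matrix (Fin d) (Fin d) ℝ) ≤ 1 := PosSemidef.one.nonneg
  have hσ₁Q' : Q⁻¹ ≤ σ₁ := inv_le_of_inv_le₀ hσ₁ (by rwa [← one_div])
  exact ⟨hd, le_trans (by exact_mod_cast hsize) hk, hw, hsum,
    fun i => (smul_le_smul_of_nonneg_right hσ₁Q' hone).trans (le_iff.2 (hcov i).1),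
    fun i => (le_iff.2 (hcov i).2).trans (smul_le_smul_of_nonneg_right hσ₂Q hone)⟩

namespace IsControlled

variable {θ : MixtureParams d} {Q : ℝ}

lemma one_le (h : θ.IsControlled Q) : 1 ≤ Q := by
  linarith [h.dim_add_one_le, d.cast_nonneg (α := ℝ)]

lemma pos (h : θ.IsControlled Q) : 0 < Q := one_pos.trans_le h.one_le

lemma posDef_cov (h : θ.IsControlled Q) (i : Fin θ.size) : (θ.cov i).PosDef :=
  posDef_of_smul_one_le (inv_pos.2 h.pos) (h.inv_smul_one_le_cov i)

lemma inv_cov_le (h : θ.IsControlled Q) (i : Fin θ.size) : (θ.cov i)⁻¹ ≤ Q • 1 := by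
  simpa using inv_le_inv_smul_one (inv_pos.2 h.pos) (h.inv_smul_one_le_cov i)

lemma dotProduct_inv_cov_mulVec_le (h : θ.IsControlled Q) (i : Fin θ.size)
    (v : EuclideanSpace ℝ (Fin d)) : v.ofLp ⬝ᵥ (θ.cov i)⁻¹ *ᵥ v.ofLp ≤ Q * ‖v‖ ^ 2 :=
  dotProduct_ofLp_self v ▸ dotProduct_mulVec_le (h.inv_cov_le i) v.ofLp

lemma norm_sq_le (h : θ.IsControlled Q) (i : Fin θ.size) (v : EuclideanSpace ℝ (Fin d)) :
    ‖v‖ ^ 2 ≤ Q * (v.ofLp ⬝ᵥ (θ.cov i)⁻¹ *ᵥ v.ofLp) := by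
  rw [← dotProduct_ofLp_self, ← inv_mul_le_iff₀ h.pos]
  exact mul_dotProduct_self_le (inv_smul_one_le_inv (h.posDef_cov i) (h.cov_le_smul_one i)) v.ofLp

lemma dotProduct_inv_cov_mulVec_nonneg (h : θ.IsControlled Q) (i : Fin θ.size)
    (v : EuclideanSpace ℝ (Fin d)) : 0 ≤ v.ofLp ⬝ᵥ (θ.cov i)⁻¹ *ᵥ v.ofLp :=
  nonneg_of_mul_nonneg_right ((sq_nonneg _).trans (h.norm_sq_le i v)) h.pos

lemma abs_gaussianLogNormalizer_cov_le (h : θ.IsControlled Q) (i : Fin θ.size) :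
    |gaussianLogNormalizer (θ.cov i)| ≤ Q ^ 2 := by
  refine (abs_gaussianLogNormalizer_le h.pos (h.inv_smul_one_le_cov i)
    (h.cov_le_smul_one i)).trans ?_
  nlinarith [h.dim_add_one_le, h.one_le]

lemma weight_le_one (h : θ.IsControlled Q) (i : Fin θ.size) : θ.weight i ≤ 1 :=
  h.sum_weight ▸ Finset.single_le_sum (fun j _ => h.weight_nonneg j) (Finset.mem_univ i)

lemma component_eq_exp (h : θ.IsControlled Q) {i : Fin θ.size} (hi : 0 < θ.weight i)
    (x : EuclideanSpace ℝ (Fin d)) : θ.component i x = Real.exp (θ.logScale i -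
      1 / 2 * ((x - θ.mean i).ofLp ⬝ᵥ (θ.cov i)⁻¹ *ᵥ (x - θ.mean i).ofLp)) := by
  rw [component, logScale, gaussianDensity_eq_exp (h.posDef_cov i).det_pos, add_sub_assoc,
    Real.exp_add, Real.exp_log hi]

lemma component_nonneg (h : θ.IsControlled Q) (i : Fin θ.size) (x : EuclideanSpace ℝ (Fin d)) :
    0 ≤ θ.component i x :=
  mul_nonneg (h.weight_nonneg i) (by unfold gaussianDensity; positivity)

lemma component_le (h : θ.IsControlled Q) (i : Fin θ.size) (x : EuclideanSpace ℝ (Fin d)) :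
    θ.component i x ≤ θ.weight i * Real.exp (Q ^ 2) := by
  rw [component, gaussianDensity_eq_exp (h.posDef_cov i).det_pos]
  refine mul_le_mul_of_nonneg_left (Real.exp_le_exp.2 ?_) (h.weight_nonneg i)
  linarith [h.dotProduct_inv_cov_mulVec_nonneg i (x - θ.mean i),
    le_of_abs_le (h.abs_gaussianLogNormalizer_cov_le i)]

lemma sum_component_pos (h : θ.IsControlled Q) (x : EuclideanSpace ℝ (Fin d)) :
    0 < ∑ i, θ.component i x := by
  obtain ⟨i, -, hi⟩ : ∃ i ∈ Finset.univ, 0 < θ.weight i :=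
    Finset.exists_lt_of_sum_lt (by rw [h.sum_weight, Finset.sum_const_zero]; exact one_pos)
  exact Finset.sum_pos' (fun j _ => h.component_nonneg j x)
    ⟨i, Finset.mem_univ i, h.component_eq_exp hi x ▸ Real.exp_pos _⟩

lemma le_mixtureScore_iff (h : θ.IsControlled Q) {x : EuclideanSpace ℝ (Fin d)} {s : ℝ} :
    s ≤ mixtureScore θ x ↔ Real.exp s ≤ ∑ i, θ.component i x :=
  Real.le_log_iff_exp_le (h.sum_component_pos x)

lemma mixtureScore_le (h : θ.IsControlled Q) (x : EuclideanSpace ℝ (Fin d)) :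
    mixtureScore θ x ≤ Q ^ 2 := by
  refine (Real.log_le_iff_le_exp (h.sum_component_pos x)).2 ?_
  calc ∑ i, θ.component i x ≤ ∑ i, θ.weight i * Real.exp (Q ^ 2) :=
        Finset.sum_le_sum fun i _ => h.component_le i x
    _ = Real.exp (Q ^ 2) := by rw [← Finset.sum_mul, h.sum_weight, one_mul]

lemma exists_exp_le_component (h : θ.IsControlled Q) {x : EuclideanSpace ℝ (Fin d)} {s : ℝ}
    (hs : s ≤ mixtureScore θ x) : ∃ i, Real.exp (s - Q) ≤ θ.component i x := by
  have hne : (Finset.univ : Finset (Fin θ.size)).Nonempty :=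
    Finset.nonempty_of_sum_ne_zero (h.sum_weight.trans_ne one_ne_zero)
  have hsize : (θ.size : ℝ) ≤ Real.exp Q :=
    h.size_le.trans (by linarith [Real.add_one_le_exp Q])
  obtain ⟨i, -, hi⟩ := Finset.exists_le_of_sum_le hne (f := fun _ => Real.exp (s - Q))
    (g := fun i => θ.component i x) <| by
      calc ∑ _i : Fin θ.size, Real.exp (s - Q) = θ.size * Real.exp (s - Q) := by
            rw [Finset.sum_const, Finset.card_univ, Fintype.card_fin, nsmul_eq_mul]
        _ ≤ Real.exp Q * Real.exp (s - Q) := by gcongr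
        _ = Real.exp s := by rw [← Real.exp_add, add_sub_cancel]
        _ ≤ ∑ i, θ.component i x := h.le_mixtureScore_iff.1 hs
  exact ⟨i, hi⟩

lemma weight_pos_of_exp_le (h : θ.IsControlled Q) {x : EuclideanSpace ℝ (Fin d)} {T : ℝ}
    {i : Fin θ.size} (hi : Real.exp (-T) ≤ θ.component i x) : 0 < θ.weight i := by
  refine (h.weight_nonneg i).lt_of_ne fun hzero => ?_
  rw [component, ← hzero, zero_mul] at hi
  exact (Real.exp_pos _).not_ge hi

lemma abs_logScale_le_of_exp_le (h : θ.IsControlled Q) {x : EuclideanSpace ℝ (Fin d)} {T : ℝ}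
    (hT : 0 ≤ T) {i : Fin θ.size} (hi : Real.exp (-T) ≤ θ.component i x) :
    |θ.logScale i| ≤ T + Q ^ 2 := by
  have hpos := h.weight_pos_of_exp_le hi
  have hnormalizer := abs_le.1 (h.abs_gaussianLogNormalizer_cov_le i)
  have hlog := Real.log_nonpos hpos.le (h.weight_le_one i)
  have hquad := h.dotProduct_inv_cov_mulVec_nonneg i (x - θ.mean i)
  rw [h.component_eq_exp hpos, Real.exp_le_exp] at hi
  rw [logScale] at hi ⊢
  exact abs_le.2 ⟨by linarith, by linarith⟩

lemma norm_sub_mean_sq_le_of_exp_le (h : θ.IsControlled Q) {x : EuclideanSpace ℝ (Fin d)} {T : ℝ}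
    {i : Fin θ.size} (hi : Real.exp (-T) ≤ θ.component i x) :
    ‖x - θ.mean i‖ ^ 2 ≤ 2 * Q * (T + Q ^ 2) := by
  have hpos := h.weight_pos_of_exp_le hi
  have hnormalizer := abs_le.1 (h.abs_gaussianLogNormalizer_cov_le i)
  have hlog := Real.log_nonpos hpos.le (h.weight_le_one i)
  rw [h.component_eq_exp hpos, Real.exp_le_exp, logScale] at hi
  rw [mul_comm 2 Q, mul_assoc]
  exact (h.norm_sq_le i _).trans (mul_le_mul_of_nonneg_left (by linarith) h.pos.le)

lemma exists_mem_le_mixtureScore (h : θ.IsControlled Q) {ν : Measure (EuclideanSpace ℝ (Fin d))}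
    [IsProbabilityMeasure ν] {B : Set (EuclideanSpace ℝ (Fin d))} (hB : MeasurableSet B)
    (hνB : 1 / 2 ≤ ν.real B) {c : ℝ} (hcQ : |c| ≤ Q) (hint : Integrable (mixtureScore θ) ν)
    (hc : c ≤ ∫ x, mixtureScore θ x ∂ν) : ∃ x ∈ B, -(5 * Q ^ 2) ≤ mixtureScore θ x := by
  by_contra! hlt
  let upper : EuclideanSpace ℝ (Fin d) → ℝ := fun x => Q ^ 2 + B.indicator (fun _ => -(6 * Q ^ 2)) x
  have hindicator := (integrable_const (μ := ν) (-(6 * Q ^ 2))).indicator hB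
  have hle : ∫ x, mixtureScore θ x ∂ν ≤ ∫ x, upper x ∂ν := by
    refine integral_mono hint ((integrable_const _).add hindicator) fun x => ?_
    by_cases hx : x ∈ B
    · simp only [upper, Set.indicator_of_mem hx]; linarith [hlt x hx]
    · simp only [upper, Set.indicator_of_notMem hx]; linarith [h.mixtureScore_le x]
  rw [integral_add (integrable_const _) hindicator, integral_indicator_const _ hB, integral_const,
    probReal_univ, one_smul, smul_eq_mul] at hle
  nlinarith [neg_abs_le c, h.one_le]

lemma logScale_sub_le_mixtureScore (h : θ.IsControlled Q) {i : Fin θ.size} (hi : 0 < θ.weight i)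
    (x : EuclideanSpace ℝ (Fin d)) :
    θ.logScale i - Q / 2 * ‖x - θ.mean i‖ ^ 2 ≤ mixtureScore θ x := by
  have hle : θ.component i x ≤ ∑ i, θ.component i x :=
    Finset.single_le_sum (fun j _ => h.component_nonneg j x) (Finset.mem_univ i)
  rw [h.component_eq_exp hi] at hle
  have hquad := h.dotProduct_inv_cov_mulVec_le i (x - θ.mean i)
  exact le_trans (by linarith) (h.le_mixtureScore_iff.2 hle)

lemma abs_mixtureScore_le (h : θ.IsControlled Q) {x₀ z : EuclideanSpace ℝ (Fin d)}
    (hz : z ∈ Metric.closedBall x₀ (4 * Q)) (hs : -(5 * Q ^ 2) ≤ mixtureScore θ z)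
    (x : EuclideanSpace ℝ (Fin d)) :
    |mixtureScore θ x| ≤ 100 * Q ^ 4 * (1 + ‖x - x₀‖ ^ 2) := by
  have hQ := h.one_le
  have hpow {a : ℕ} (ha : a ≤ 4) : Q ^ a ≤ Q ^ 4 := pow_le_pow_right₀ hQ ha
  obtain ⟨i, hi⟩ := h.exists_exp_le_component hs
  replace hi : Real.exp (-(6 * Q ^ 2)) ≤ θ.component i z :=
    (Real.exp_le_exp.2 (by nlinarith)).trans hi
  have hscale := abs_le.1 (h.abs_logScale_le_of_exp_le (by positivity) hi)
  have hmean := h.norm_sub_mean_sq_le_of_exp_le hi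
  have hz' : ‖z - x₀‖ ^ 2 ≤ (4 * Q) ^ 2 :=
    pow_le_pow_left₀ (norm_nonneg _) (by simpa [dist_eq_norm] using hz) 2
  have hdist : ‖x - θ.mean i‖ ^ 2 ≤
      2 * ‖x - x₀‖ ^ 2 + 4 * ‖z - x₀‖ ^ 2 + 4 * ‖z - θ.mean i‖ ^ 2 := by
    have hsq := norm_sub_sq_le_two_mul_add x₀ z (θ.mean i)
    rw [norm_sub_rev x₀ z] at hsq
    linarith [norm_sub_sq_le_two_mul_add x x₀ (θ.mean i)]
  have hlower := h.logScale_sub_le_mixtureScore (h.weight_pos_of_exp_le hi) x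
  have hdistQ := mul_le_mul_of_nonneg_left hdist h.pos.le
  have hzQ := mul_le_mul_of_nonneg_left hz' h.pos.le
  have hmeanQ := mul_le_mul_of_nonneg_left hmean h.pos.le
  have hgrowth := mul_le_mul_of_nonneg_right (hpow (a := 1) (by norm_num)) (sq_nonneg ‖x - x₀‖)
  have hnonneg : 0 ≤ Q ^ 4 * ‖x - x₀‖ ^ 2 := by positivity
  have hpow2 := hpow (a := 2) (by norm_num)
  have hpow3 := hpow (a := 3) (by norm_num)
  exact abs_le.2 ⟨by linarith, by linarith [h.mixtureScore_le x]⟩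

end IsControlled

end MixtureParams

end ControlledMixtures

section QuadraticFeatures

open Matrix
open scoped MatrixOrder

variable {d : ℕ}

/-- The homogeneous coordinates `(1, x - x₀)` of `x`, the coordinate `1` being indexed by `none`. -/
def homogeneousCoord (x₀ x : EuclideanSpace ℝ (Fin d)) : Option (Fin d) → ℝ
  | none => 1
  | some a => (x - x₀) a

/-- The columns of the linear map taking the homogeneous coordinates of `x` to `x - x₀ - u`. -/
def translationColumn (u : EuclideanSpace ℝ (Fin d)) : Option (Fin d) → Fin d → ℝ
  | none => -u.ofLp
  | some a => Pi.single a 1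

/-- The monomials of degree at most two in the coordinates of `x - x₀`, as products of two
homogeneous coordinates. -/
def quadraticFeature (x₀ : EuclideanSpace ℝ (Fin d)) (s : Option (Fin d) × Option (Fin d))
    (x : EuclideanSpace ℝ (Fin d)) : ℝ :=
  homogeneousCoord x₀ x s.1 * homogeneousCoord x₀ x s.2

/-- The coefficients of `r - (x - x₀ - u) ⬝ P (x - x₀ - u) / 2` in the quadratic features. -/
noncomputable def quadraticCoeff (r : ℝ) (P : Matrix (Fin d) (Fin d) ℝ)
    (u : EuclideanSpace ℝ (Fin d)) (s : Option (Fin d) × Option (Fin d)) : ℝ :=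
  (if s = (none, none) then r else 0) -
    1 / 2 * (translationColumn u s.1 ⬝ᵥ P *ᵥ translationColumn u s.2)

lemma measurable_quadraticFeature (x₀ : EuclideanSpace ℝ (Fin d))
    (s : Option (Fin d) × Option (Fin d)) : Measurable (quadraticFeature x₀ s) := by
  have hcoord (t : Option (Fin d)) : Measurable fun x => homogeneousCoord x₀ x t := by
    cases t <;> simp only [homogeneousCoord] <;> fun_prop
  exact (hcoord s.1).mul (hcoord s.2)

lemma abs_quadraticFeature_le {x₀ x : EuclideanSpace ℝ (Fin d)} {R : ℝ} (hR : 1 ≤ R)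
    (hx : ‖x - x₀‖ ≤ R) (s : Option (Fin d) × Option (Fin d)) :
    |quadraticFeature x₀ s x| ≤ R ^ 2 := by
  have hcoord : ∀ t, |homogeneousCoord x₀ x t| ≤ R
    | none => abs_one.trans_le hR
    | some a => (PiLp.norm_apply_le (x - x₀) a).trans hx
  rw [quadraticFeature, abs_mul, pow_two]
  exact mul_le_mul (hcoord s.1) (hcoord s.2) (abs_nonneg _) (by linarith)

lemma sum_homogeneousCoord_smul_translationColumn (x₀ μ x : EuclideanSpace ℝ (Fin d)) :
    ∑ t, homogeneousCoord x₀ x t • translationColumn (μ - x₀) t = (x - μ).ofLp := by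
  ext a
  simp [Fintype.sum_option, homogeneousCoord, translationColumn, Pi.single_apply]

lemma sum_quadraticCoeff_mul (r : ℝ) (P : Matrix (Fin d) (Fin d) ℝ)
    (x₀ μ x : EuclideanSpace ℝ (Fin d)) :
    ∑ s, quadraticCoeff r P (μ - x₀) s * quadraticFeature x₀ s x =
      r - 1 / 2 * ((x - μ).ofLp ⬝ᵥ P *ᵥ (x - μ).ofLp) := by
  simp only [← sum_homogeneousCoord_smul_translationColumn x₀ μ x, mulVec_sum, sum_dotProduct,
    dotProduct_sum, mulVec_smul, smul_dotProduct, dotProduct_smul, smul_eq_mul, quadraticCoeff,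
    sub_mul, Finset.sum_sub_distrib, Finset.mul_sum]
  rw [← Fintype.sum_prod_type_right']
  congr 1
  · simp [quadraticFeature, homogeneousCoord]
  · exact Finset.sum_congr rfl fun s _ => by rw [quadraticFeature]; ring

lemma abs_quadraticCoeff_le {r Q V : ℝ} {P : Matrix (Fin d) (Fin d) ℝ} (hP : P.PosSemidef)
    (hPQ : P ≤ Q • 1) (hQ : 0 ≤ Q) {u : EuclideanSpace ℝ (Fin d)} (hu : ‖u‖ ^ 2 ≤ V) (hV : 1 ≤ V)
    (s : Option (Fin d) × Option (Fin d)) : |quadraticCoeff r P u s| ≤ |r| + Q * V / 2 := by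
  have hcolumn : ∀ t, translationColumn u t ⬝ᵥ translationColumn u t ≤ V
    | none => by simpa [translationColumn, dotProduct_ofLp_self] using hu
    | some a => by simpa [translationColumn] using hV
  have hconst : |if s = (none, none) then r else 0| ≤ |r| := by split_ifs <;> simp
  have hquad := abs_dotProduct_mulVec_le hP hPQ (translationColumn u s.1) (translationColumn u s.2)
  have hV' := mul_le_mul_of_nonneg_left (add_le_add (hcolumn s.1) (hcolumn s.2)) hQ
  rw [quadraticCoeff]
  refine (abs_sub _ _).trans (add_le_add hconst ?_)
  rw [abs_mul, abs_of_pos one_half_pos]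
  linarith

lemma exists_coeff_const {T : ℝ} (hT : 0 ≤ T) :
    ∃ w : Option (Fin d) × Option (Fin d) → ℝ, (∀ s, |w s| ≤ T) ∧
      ∀ x₀ x, ∑ s, w s * quadraticFeature x₀ s x = -T := by
  refine ⟨Pi.single (none, none) (-T), fun s => ?_, fun x₀ x => ?_⟩
  · rw [Pi.single_apply]
    split_ifs
    · rw [abs_neg, abs_of_nonneg hT]
    · rwa [abs_zero]
  · simp [Pi.single_apply, quadraticFeature, homogeneousCoord]

/-- A bound, on the ball of radius `R`, for the quadratic coefficients of those components of a
mixture controlled by `Q` that reach the value `exp (-T)` in this ball. -/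
noncomputable def coeffBound (Q R T : ℝ) : ℝ :=
  T + Q ^ 2 + Q * (R ^ 2 + 2 * Q * (T + Q ^ 2))

lemma le_coeffBound {Q : ℝ} (hQ : 0 ≤ Q) (R : ℝ) {T : ℝ} (hT : 0 ≤ T) : T ≤ coeffBound Q R T := by
  have : 0 ≤ Q ^ 2 + Q * (R ^ 2 + 2 * Q * (T + Q ^ 2)) := by positivity
  rw [coeffBound]
  linarith

lemma abs_log_sub_log_le {s s' τ b : ℝ} (hs : Real.exp (-b) ≤ s) (hss' : s ≤ s')
    (hs' : s' ≤ s + τ) : |Real.log s - Real.log s'| ≤ τ * Real.exp b := by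
  have hpos : 0 < s := (Real.exp_pos _).trans_le hs
  have hpos' : 0 < s' := hpos.trans_le hss'
  have hinv : s⁻¹ ≤ Real.exp b := inv_le_of_inv_le₀ (Real.exp_pos b) (by rwa [← Real.exp_neg])
  rw [abs_sub_comm, abs_of_nonneg (sub_nonneg.2 (Real.log_le_log hpos hss')),
    ← Real.log_div hpos'.ne' hpos.ne']
  calc Real.log (s' / s) ≤ s' / s - 1 := Real.log_le_sub_one_of_pos (by positivity)
    _ = (s' - s) * s⁻¹ := by field_simp
    _ ≤ τ * Real.exp b := by gcongr <;> linarith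

namespace MixtureParams.IsControlled

variable {θ : MixtureParams d} {Q R T : ℝ} {x₀ : EuclideanSpace ℝ (Fin d)}

/-- Where a component never exceeds `exp (-T)`, the constant `exp (-T)` replaces it: this keeps
the coefficients bounded although the weight may vanish and the mean may be far away. -/
lemma exists_coeff_component_le_exp (h : θ.IsControlled Q) (hR : 1 ≤ R) (hT : 0 ≤ T)
    (i : Fin θ.size) :
    ∃ w : Option (Fin d) × Option (Fin d) → ℝ,
      (∀ s, |w s| ≤ coeffBound Q R T) ∧
      ∀ x ∈ Metric.closedBall x₀ R,
        θ.component i x ≤ Real.exp (∑ s, w s * quadraticFeature x₀ s x) ∧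
        Real.exp (∑ s, w s * quadraticFeature x₀ s x) ≤ θ.component i x + Real.exp (-T) := by
  have hQ := h.pos
  by_cases hbig : ∃ z ∈ Metric.closedBall x₀ R, Real.exp (-T) ≤ θ.component i z
  · obtain ⟨z, hz, hi⟩ := hbig
    have hV : ‖θ.mean i - x₀‖ ^ 2 ≤ 2 * R ^ 2 + 2 * (2 * Q * (T + Q ^ 2)) := by
      have hz' : ‖z - x₀‖ ≤ R := by simpa [dist_eq_norm] using hz
      have hsq := norm_sub_sq_le_two_mul_add (θ.mean i) z x₀
      rw [norm_sub_rev _ z] at hsq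
      linarith [pow_le_pow_left₀ (norm_nonneg _) hz' 2, h.norm_sub_mean_sq_le_of_exp_le hi]
    refine ⟨quadraticCoeff (θ.logScale i) (θ.cov i)⁻¹ (θ.mean i - x₀), fun s => ?_, fun x _ => ?_⟩
    · have hV₁ : 1 ≤ 2 * R ^ 2 + 2 * (2 * Q * (T + Q ^ 2)) := by
        have : 0 ≤ Q * (T + Q ^ 2) := by positivity
        nlinarith
      rw [coeffBound]
      linarith [abs_quadraticCoeff_le (r := θ.logScale i) (h.posDef_cov i).inv.posSemidef
        (h.inv_cov_le i) hQ.le hV hV₁ s, h.abs_logScale_le_of_exp_le hT hi]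
    · rw [sum_quadraticCoeff_mul, ← h.component_eq_exp (h.weight_pos_of_exp_le hi)]
      exact ⟨le_rfl, le_add_of_nonneg_right (Real.exp_pos _).le⟩
  · push Not at hbig
    obtain ⟨w, hw, hwx⟩ := exists_coeff_const (d := d) hT
    refine ⟨w, fun s => (hw s).trans (le_coeffBound hQ.le R hT), fun x hx => ?_⟩
    rw [hwx]
    exact ⟨(hbig x hx).le, le_add_of_nonneg_left (h.component_nonneg i x)⟩

lemma exists_logSumExpFeatures_approx (h : θ.IsControlled Q) {k : ℕ} (hk : θ.size ≤ k)
    (hR : 1 ≤ R) (hT : 0 ≤ T) {b : ℝ} (hb : ∀ x ∈ Metric.closedBall x₀ R, -b ≤ mixtureScore θ x) :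
    ∃ w : Fin k → Option (Fin d) × Option (Fin d) → ℝ,
      (∀ i s, |w i s| ≤ coeffBound Q R T) ∧
      ∀ x ∈ Metric.closedBall x₀ R,
        |mixtureScore θ x - logSumExpFeatures (quadraticFeature x₀) w x| ≤
          k * Real.exp (-T) * Real.exp b := by
  obtain ⟨e, rfl⟩ := Nat.exists_eq_add_of_le hk
  choose w hw hwx using h.exists_coeff_component_le_exp (x₀ := x₀) hR hT
  obtain ⟨v, hv, hvx⟩ := exists_coeff_const (d := d) hT
  refine ⟨Fin.append w fun _ => v, fun i s => ?_, fun x hx =>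
    abs_log_sub_log_le (h.le_mixtureScore_iff.1 (hb x hx)) ?_ ?_⟩
  · refine Fin.addCases (fun i => ?_) (fun i => ?_) i
    · simpa only [Fin.append_left] using hw i s
    · simpa only [Fin.append_right] using (hv s).trans (le_coeffBound h.pos.le R hT)
  · rw [Fin.sum_univ_add]
    simp only [Fin.append_left, Fin.append_right]
    exact (Finset.sum_le_sum fun i _ => (hwx i x hx).1).trans
      (le_add_of_nonneg_right (Finset.sum_nonneg fun _ _ => (Real.exp_pos _).le))
  · rw [Fin.sum_univ_add]
    simp only [Fin.append_left, Fin.append_right, hvx]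
    have hsum := Finset.sum_le_sum fun i (_ : i ∈ Finset.univ) => (hwx i x hx).2
    rw [Finset.sum_add_distrib] at hsum
    simp only [Finset.sum_const, Finset.card_univ, Fintype.card_fin, nsmul_eq_mul] at hsum ⊢
    push_cast
    unfold component at hsum
    linarith

end MixtureParams.IsControlled

end QuadraticFeatures

section ScoreDeviation

lemma two_mul_pow_le_mul_exp {N N₀ a δ L : ℝ} {n : ℕ} (hN : 1 ≤ N) (hNN₀ : N ≤ N₀) (hna : n ≤ a)
    (hδ : 0 < δ) (hL : Real.log 2 + a * Real.log N₀ + Real.log (1 / δ) ≤ L) :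
    2 * N ^ n ≤ δ * Real.exp L := by
  have hpos : 0 < N := by linarith
  have hlog : n * Real.log N ≤ a * Real.log N₀ :=
    mul_le_mul hna (Real.log_le_log hpos hNN₀) (Real.log_nonneg hN) (n.cast_nonneg.trans hna)
  rw [one_div, Real.log_inv] at hL
  rw [← Real.log_le_log_iff (by positivity) (by positivity),
    Real.log_mul two_ne_zero (by positivity), Real.log_pow,
    Real.log_mul hδ.ne' (Real.exp_pos L).ne', Real.log_exp]
  linarith

lemma coeffBound_le {Q R m : ℝ} (hQ : 1 ≤ Q) (hR : 1 ≤ R) (hm : 1 ≤ m) :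
    coeffBound Q R (200 * Q ^ 4 * R ^ 2 + Q + m) ≤ 610 * (Q ^ 6 * R ^ 2 * m) := by
  have hRm : 1 ≤ R ^ 2 * m := one_le_mul_of_one_le_of_one_le (one_le_pow₀ hR) hm
  have hQ4 {n : ℕ} (hn : n ≤ 4) : Q ^ n ≤ Q ^ 4 * R ^ 2 * m := by
    rw [mul_assoc]
    exact (pow_le_pow_right₀ hQ hn).trans (le_mul_of_one_le_right (by positivity) hRm)
  have hQ46 : Q ^ 4 * R ^ 2 * m ≤ Q ^ 6 * R ^ 2 * m := by gcongr; norm_num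
  have hQR {n : ℕ} (hn : n ≤ 6) : Q ^ n * R ^ 2 ≤ Q ^ 6 * R ^ 2 * m := by
    calc Q ^ n * R ^ 2 ≤ Q ^ 6 * R ^ 2 := by gcongr
      _ ≤ Q ^ 6 * R ^ 2 * m := le_mul_of_one_le_right (by positivity) hm
  have hcutoff : 200 * Q ^ 4 * R ^ 2 + Q + m ≤ 202 * (Q ^ 4 * R ^ 2 * m) := by
    have hleft := le_mul_of_one_le_right (a := Q ^ 4 * R ^ 2) (by positivity) hm
    have hright := le_mul_of_one_le_left (zero_le_one.trans hm) (one_le_mul_of_one_le_of_one_le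
      (one_le_pow₀ (n := 4) hQ) (one_le_pow₀ (n := 2) hR))
    linarith [hQ4 (n := 1) (by norm_num)]
  have hmul := mul_le_mul_of_nonneg_left (add_le_add hcutoff (hQ4 (n := 2) (by norm_num)))
    (sq_nonneg Q)
  rw [coeffBound]
  linarith [hQ4 (n := 2) (by norm_num), hQR (n := 1) (by norm_num)]

lemma two_mul_ceil_add_one_le {Q R W D m : ℝ} (hQ : 1 ≤ Q) (hR : 1 ≤ R) (hm : 1 ≤ m)
    (hW : W ≤ 610 * (Q ^ 6 * R ^ 2 * m)) (hD₀ : 0 ≤ D) (hD : D ≤ Q ^ 2) :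
    2 * (⌈W * (m * D * R ^ 2)⌉₊ : ℝ) + 1 ≤ 2 ^ 11 * (Q ^ 8 * R ^ 4 * m ^ 2) := by
  have hone : 1 ≤ Q ^ 8 * R ^ 4 * m ^ 2 := one_le_mul_of_one_le_of_one_le
    (one_le_mul_of_one_le_of_one_le (one_le_pow₀ hQ) (one_le_pow₀ hR)) (one_le_pow₀ hm)
  have hle : W * (m * D * R ^ 2) ≤ 610 * (Q ^ 8 * R ^ 4 * m ^ 2) := by
    calc W * (m * D * R ^ 2) ≤ 610 * (Q ^ 6 * R ^ 2 * m) * (m * Q ^ 2 * R ^ 2) := by gcongr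
      _ = 610 * (Q ^ 8 * R ^ 4 * m ^ 2) := by ring
  have hceil : (⌈W * (m * D * R ^ 2)⌉₊ : ℝ) ≤ 611 * (Q ^ 8 * R ^ 4 * m ^ 2) := by
    refine (Nat.cast_le.2 (Nat.ceil_mono hle)).trans ((Nat.ceil_lt_add_one ?_).le.trans ?_)
    · positivity
    · linarith
  linarith

lemma mul_exp_neg_cutoff_le {k b Q m : ℝ} (hkQ : k ≤ Q) (hm : 0 < m) :
    k * Real.exp (-(b + Q + m)) * Real.exp b ≤ 1 / m := by
  have hQexp := Real.add_one_le_exp Q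
  have hmexp := Real.add_one_le_exp m
  have hsplit : Real.exp (-(b + Q + m)) * Real.exp b = (Real.exp Q * Real.exp m)⁻¹ := by
    rw [← Real.exp_add, ← Real.exp_add, ← Real.exp_neg]
    congr 1
    ring
  rw [mul_assoc, hsplit, ← div_eq_mul_inv, div_le_div_iff₀ (by positivity) hm, one_mul]
  exact mul_le_mul (by linarith) (by linarith) hm.le (Real.exp_pos Q).le

variable {d k m : ℕ} {Q R δ L : ℝ}

lemma two_mul_netSize_pow_le (hd : (d : ℝ) + 1 ≤ Q) (hk : (k : ℝ) ≤ Q) (hR : 1 ≤ R) (hm : 0 < m)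
    (hδ : 0 < δ)
    (hlog : Real.log 2 + Q ^ 3 * Real.log (2 ^ 11 * (Q ^ 8 * R ^ 4 * m ^ 2)) +
      Real.log (1 / δ) ≤ L) :
    2 * (2 * (⌈coeffBound Q R (200 * Q ^ 4 * R ^ 2 + Q + m) *
        (m * Fintype.card (Option (Fin d) × Option (Fin d)) * R ^ 2)⌉₊ : ℝ) + 1) ^
          (k * Fintype.card (Option (Fin d) × Option (Fin d))) ≤ δ * Real.exp L := by
  have hQ : 1 ≤ Q := by linarith [d.cast_nonneg (α := ℝ)]
  have hm₁ : (1 : ℝ) ≤ m := by exact_mod_cast hm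
  have hcard : (Fintype.card (Option (Fin d) × Option (Fin d)) : ℝ) ≤ Q ^ 2 := by
    calc (Fintype.card (Option (Fin d) × Option (Fin d)) : ℝ) = (d + 1) ^ 2 := by simp [sq]
      _ ≤ Q ^ 2 := by gcongr
  refine two_mul_pow_le_mul_exp (by simp) (two_mul_ceil_add_one_le hQ hR hm₁
    (coeffBound_le hQ hR hm₁) (Nat.cast_nonneg _) hcard) ?_ hδ hlog
  rw [Nat.cast_mul]
  calc (k : ℝ) * Fintype.card (Option (Fin d) × Option (Fin d)) ≤ Q * Q ^ 2 := by gcongr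
    _ = Q ^ 3 := by ring

lemma measure_pi_exists_isControlled_lt_abs_le (ρ : Measure (EuclideanSpace ℝ (Fin d)))
    [IsProbabilityMeasure ρ] (hm : 0 < m) (x₀ : EuclideanSpace ℝ (Fin d)) (hd : (d : ℝ) + 1 ≤ Q)
    (hk : (k : ℝ) ≤ Q) (hR : 1 ≤ R) (hδ : 0 < δ) (hL : 0 ≤ L)
    (hlog : Real.log 2 + Q ^ 3 * Real.log (2 ^ 11 * (Q ^ 8 * R ^ 4 * m ^ 2)) +
      Real.log (1 / δ) ≤ L) :
    (Measure.pi fun _ : Fin m => ρ) {x | (∀ j, x j ∈ Metric.closedBall x₀ R) ∧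
        ∃ θ : MixtureParams d, θ.IsControlled Q ∧ θ.size ≤ k ∧
          (∀ y, |mixtureScore θ y| ≤ 100 * Q ^ 4 * (1 + ‖y - x₀‖ ^ 2)) ∧
          200 * Q ^ 4 * R ^ 2 * √(2 * L / m) + 4 / m <
            |∫ y in Metric.closedBall x₀ R, mixtureScore θ y ∂ρ -
              (m : ℝ)⁻¹ * ∑ j, mixtureScore θ (x j)|} ≤ ENNReal.ofReal δ := by
  have hQ : 1 ≤ Q := by linarith [d.cast_nonneg (α := ℝ)]
  have : (1 : ℝ) ≤ m := by exact_mod_cast hm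
  have hball : ∀ y ∈ Metric.closedBall x₀ R, ‖y - x₀‖ ≤ R := fun y hy => by
    simpa [dist_eq_norm] using hy
  set b := 200 * Q ^ 4 * R ^ 2 with hb
  set D := (Fintype.card (Option (Fin d) × Option (Fin d)) : ℝ)
  set η := (m * D * R ^ 2)⁻¹ with hη
  have hDpos : 0 < D := Nat.cast_pos.2 Fintype.card_pos
  have hηpos : 0 < η := by positivity
  refine (measure_mono fun x hx => ?_).trans (measure_pi_exists_logSumExpFeatures_lt_abs_le ρ hm k
    (measurable_quadraticFeature x₀) Metric.isClosed_closedBall.measurableSet (sq_nonneg R)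
    (fun y hy => abs_quadraticFeature_le hR (hball y hy)) (b := b) (η := η) (ε := 1 / m)
    (by positivity) hηpos ⌈coeffBound Q R (b + Q + m) * (m * D * R ^ 2)⌉₊ hL
    (two_mul_netSize_pow_le hd hk hR hm hδ hlog))
  obtain ⟨hxB, θ, hθ, hsize, hgrowth, hdev⟩ := hx
  have hbound : ∀ y ∈ Metric.closedBall x₀ R, |mixtureScore θ y| ≤ b := fun y hy => by
    have := pow_le_pow_left₀ (norm_nonneg _) (hball y hy) 2
    calc |mixtureScore θ y| ≤ 100 * Q ^ 4 * (1 + ‖y - x₀‖ ^ 2) := hgrowth y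
      _ ≤ 100 * Q ^ 4 * (2 * R ^ 2) := by gcongr; nlinarith
      _ = b := by rw [hb]; ring
  obtain ⟨w, hw, hwθ⟩ := hθ.exists_logSumExpFeatures_approx hsize hR
    (T := b + Q + m) (by positivity) fun y hy => (abs_le.1 (hbound y hy)).1
  refine ⟨hxB, mixtureScore θ, θ.measurable_mixtureScore, hbound, ⟨w, fun i s => ?_, fun y hy =>
    (hwθ y hy).trans (mul_exp_neg_cutoff_le hk (by positivity))⟩, hdev.trans_le' (le_of_eq ?_)⟩
  · rw [hη, ← div_eq_mul_inv, le_div_iff₀ (by positivity)]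
    exact (mul_le_mul_of_nonneg_right (hw i s) (by positivity)).trans (Nat.le_ceil _)
  · rw [hη]
    field_simp
    ring

end ScoreDeviation

section Rates

lemma log_le_natCast_mul_rpow_inv {a : ℝ} (ha : 0 < a) {p : ℕ} (hp : 0 < p) :
    Real.log a ≤ p * a ^ (p : ℝ)⁻¹ := by
  have hp' : (0 : ℝ) < p := by exact_mod_cast hp
  have hlog := Real.log_le_sub_one_of_pos (Real.rpow_pos_of_pos ha (p : ℝ)⁻¹)
  rw [Real.log_rpow ha, inv_mul_eq_div, div_le_iff₀ hp'] at hlog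
  linarith

lemma rpow_inv_pow_mul_rpow_inv_pow_div_sqrt {m δ : ℝ} (hm : 0 < m) (hδ : 0 < δ) (p : ℕ) :
    (m ^ (p : ℝ)⁻¹) ^ 3 * ((1 / δ) ^ (p : ℝ)⁻¹) ^ 4 / √m =
      m ^ (-(1 / 2 : ℝ) + 3 / p) * (1 / δ) ^ (4 / (p : ℝ)) := by
  rw [← Real.rpow_natCast, ← Real.rpow_natCast, ← Real.rpow_mul hm.le,
    ← Real.rpow_mul (by positivity), Real.sqrt_eq_rpow, Real.rpow_add hm, Real.rpow_neg hm.le]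
  push_cast
  rw [inv_mul_eq_div, inv_mul_eq_div]
  ring

/-- The radius of the ball to which a measure with order-`p` moment bound `M` is truncated: a
sample of size `m` leaves this ball with probability at most `δ`. -/
noncomputable def truncationRadius (p m : ℕ) (M δ : ℝ) : ℝ :=
  ((M + 1) * m * (1 / δ)) ^ (p : ℝ)⁻¹

lemma truncationRadius_pow {p : ℕ} (hp : p ≠ 0) (m : ℕ) {M δ : ℝ} (hM : 0 ≤ M) (hδ : 0 < δ) :
    truncationRadius p m M δ ^ p = (M + 1) * m * (1 / δ) :=
  Real.rpow_inv_natCast_pow (by positivity) hp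

lemma rpow_inv_le_truncationRadius (p m : ℕ) {M δ : ℝ} (hM : 0 ≤ M) (hδ : 0 < δ) (hδ₁ : δ ≤ 1) :
    (m : ℝ) ^ (p : ℝ)⁻¹ ≤ truncationRadius p m M δ := by
  refine Real.rpow_le_rpow m.cast_nonneg ?_ (by positivity)
  calc (m : ℝ) = 1 * m * 1 := by ring
    _ ≤ (M + 1) * m * (1 / δ) := by
      gcongr
      · linarith
      · exact one_le_one_div hδ hδ₁

lemma truncationRadius_le (p m : ℕ) {M δ : ℝ} (hM : 0 ≤ M) (hδ : 0 < δ) :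
    truncationRadius p m M δ ≤ (M + 1) * (m : ℝ) ^ (p : ℝ)⁻¹ * (1 / δ) ^ (p : ℝ)⁻¹ := by
  have hle : (M + 1) ^ (p : ℝ)⁻¹ ≤ M + 1 := by
    simpa using Real.rpow_le_rpow_of_exponent_le (by linarith : 1 ≤ M + 1) p.cast_inv_le_one
  rw [truncationRadius, Real.mul_rpow (by positivity) (by positivity),
    Real.mul_rpow (by positivity) (by positivity)]
  gcongr

variable {Q R X Y m : ℝ}

lemma log_netSize_le {δ : ℝ} (hQ : 1 ≤ Q) (hX : 1 ≤ X) (hY : 1 ≤ Y) (hR : 1 ≤ R)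
    (hRle : R ≤ Q * X * Y) (hm : 1 ≤ m) (hlogm : Real.log m ≤ Q * X)
    (hlogδ : Real.log (1 / δ) ≤ Q * Y) :
    Real.log 2 + Q ^ 3 * Real.log (2 ^ 11 * (Q ^ 8 * R ^ 4 * m ^ 2)) + Real.log (1 / δ) ≤
      16 * (Q ^ 4 * X * Y) := by
  have hlog₂ := Real.log_two_lt_d9
  have hQX : Q * X ≤ Q * X * Y := le_mul_of_one_le_right (by positivity) hY
  have hQXY : Q ≤ Q * X := le_mul_of_one_le_right (by positivity) hX
  have hlogN : Real.log (2 ^ 11 * (Q ^ 8 * R ^ 4 * m ^ 2)) ≤ 14 * (Q * X * Y) := by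
    rw [Real.log_mul (by positivity) (by positivity), Real.log_mul (by positivity) (by positivity),
      Real.log_mul (by positivity) (by positivity), Real.log_pow, Real.log_pow, Real.log_pow,
      Real.log_pow]
    push_cast
    linarith [Real.log_le_sub_one_of_pos (zero_lt_one.trans_le hQ),
      Real.log_le_sub_one_of_pos (zero_lt_one.trans_le hR)]
  have hone : 1 ≤ Q ^ 4 * X * Y := one_le_mul_of_one_le_of_one_le
    (one_le_mul_of_one_le_of_one_le (one_le_pow₀ hQ) hX) hY
  have hδ : Q * Y ≤ Q ^ 4 * X * Y := by
    gcongr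
    exact (le_self_pow₀ hQ (by norm_num)).trans (le_mul_of_one_le_right (by positivity) hX)
  have hnet : Q ^ 3 * Real.log (2 ^ 11 * (Q ^ 8 * R ^ 4 * m ^ 2)) ≤ 14 * (Q ^ 4 * X * Y) := by
    calc _ ≤ Q ^ 3 * (14 * (Q * X * Y)) := by gcongr
      _ = 14 * (Q ^ 4 * X * Y) := by ring
  calc _ ≤ Q ^ 4 * X * Y + 14 * (Q ^ 4 * X * Y) + Q ^ 4 * X * Y :=
        add_le_add (add_le_add (by linarith) hnet) (hlogδ.trans hδ)
    _ = 16 * (Q ^ 4 * X * Y) := by ring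

lemma concentration_rate_le (hX : 1 ≤ X) (hY : 1 ≤ Y) (hR : 0 ≤ R)
    (hRle : R ≤ Q * X * Y) :
    200 * Q ^ 4 * R ^ 2 * √(2 * (16 * (Q ^ 4 * X * Y)) / m) ≤
      1200 * (Q ^ 8 * (X ^ 3 * Y ^ 4 / √m)) := by
  have hsqrt : √(2 * (16 * (Q ^ 4 * X * Y))) ≤ 6 * Q ^ 2 * X * Y ^ 2 := by
    refine Real.sqrt_le_iff.2 ⟨by positivity, ?_⟩
    calc 2 * (16 * (Q ^ 4 * X * Y)) ≤ 36 * (Q ^ 4 * X ^ 2 * Y ^ 4) := by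
          rw [← mul_assoc]
          gcongr
          · norm_num
          · exact le_self_pow₀ hX two_ne_zero
          · exact le_self_pow₀ hY (by norm_num)
      _ = (6 * Q ^ 2 * X * Y ^ 2) ^ 2 := by ring
  rw [Real.sqrt_div (by positivity)]
  calc 200 * Q ^ 4 * R ^ 2 * (√(2 * (16 * (Q ^ 4 * X * Y))) / √m)
      ≤ 200 * Q ^ 4 * (Q * X * Y) ^ 2 * (6 * Q ^ 2 * X * Y ^ 2 / √m) := by gcongr
    _ = 1200 * (Q ^ 8 * (X ^ 3 * Y ^ 4 / √m)) := by ring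

lemma tail_rate_le {M : ℝ} {p : ℕ} (hp : 2 ≤ p) (hQ : 1 ≤ Q) (hMQ : M ≤ Q)
    (hX : 1 ≤ X) (hY : 1 ≤ Y) (hm : 1 ≤ m) (hXp : X ^ p = m) (hXR : X ≤ R) :
    2 * (100 * Q ^ 4) * M / R ^ (p - 2) ≤ 200 * (Q ^ 8 * (X ^ 3 * Y ^ 4 / √m)) := by
  have hR : 0 < R := by linarith
  have hsqrt : √m ≤ m := Real.sqrt_le_iff.2 ⟨by positivity, le_self_pow₀ hm two_ne_zero⟩
  have hpow : m ≤ R ^ (p - 2) * X ^ 3 := by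
    calc m = X ^ (p - 2) * X ^ 2 := by rw [← hXp, ← pow_add, Nat.sub_add_cancel hp]
      _ ≤ R ^ (p - 2) * X ^ 3 := by gcongr; norm_num
  have hone : 1 ≤ R ^ (p - 2) * (X ^ 3 * Y ^ 4) / √m := by
    rw [one_le_div (Real.sqrt_pos.2 (by positivity)), ← mul_assoc]
    exact (hsqrt.trans hpow).trans (le_mul_of_one_le_right (by positivity) (one_le_pow₀ hY))
  rw [div_le_iff₀ (by positivity)]
  calc 2 * (100 * Q ^ 4) * M ≤ 2 * (100 * Q ^ 4) * Q ^ 4 := by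
        gcongr
        exact hMQ.trans (le_self_pow₀ hQ (by norm_num))
    _ = 200 * Q ^ 8 * 1 := by ring
    _ ≤ 200 * Q ^ 8 * (R ^ (p - 2) * (X ^ 3 * Y ^ 4) / √m) := by gcongr
    _ = 200 * (Q ^ 8 * (X ^ 3 * Y ^ 4 / √m)) * R ^ (p - 2) := by ring

lemma four_div_le_rate (hQ : 1 ≤ Q) (hX : 1 ≤ X) (hY : 1 ≤ Y) (hm : 1 ≤ m) :
    4 / m ≤ 4 * (Q ^ 8 * (X ^ 3 * Y ^ 4 / √m)) := by
  have hsqrt : √m ≤ m := Real.sqrt_le_iff.2 ⟨by positivity, le_self_pow₀ hm two_ne_zero⟩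
  have hone : 1 ≤ Q ^ 8 * (X ^ 3 * Y ^ 4) := one_le_mul_of_one_le_of_one_le (one_le_pow₀ hQ)
    (one_le_mul_of_one_le_of_one_le (one_le_pow₀ hX) (one_le_pow₀ hY))
  calc 4 / m ≤ 4 * (Q ^ 8 * (X ^ 3 * Y ^ 4)) / √m := by gcongr; linarith
    _ = 4 * (Q ^ 8 * (X ^ 3 * Y ^ 4 / √m)) := by ring

end Rates

section UniformDeviation

variable {d k p m : ℕ} {M σ₁ σ₂ c δ Q R L : ℝ} {ρ : Measure (EuclideanSpace ℝ (Fin d))}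
  [IsProbabilityMeasure ρ]

lemma MixtureParams.abs_mixtureScore_le_of_mem_mogClass {θ : MixtureParams d}
    {ν : Measure (EuclideanSpace ℝ (Fin d))} [IsProbabilityMeasure ν]
    (hθ : θ ∈ mogClass ν c k σ₁ σ₂) (hcontrol : θ.IsControlled Q) (hc : |c| ≤ Q)
    {x₀ : EuclideanSpace ℝ (Fin d)} (hν : 1 / 2 ≤ ν.real (Metric.closedBall x₀ (4 * Q)))
    (x : EuclideanSpace ℝ (Fin d)) :
    |mixtureScore θ x| ≤ 100 * Q ^ 4 * (1 + ‖x - x₀‖ ^ 2) := by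
  obtain ⟨-, -, -, -, hint, hle⟩ := hθ
  obtain ⟨z, hz, hscore⟩ := hcontrol.exists_mem_le_mixtureScore
    Metric.isClosed_closedBall.measurableSet hν hc hint hle
  exact hcontrol.abs_mixtureScore_le hz hscore x

lemma HasMomentBound.three_fourths_le_measureReal_closedBall (h : HasMomentBound ρ p M)
    (hp : 1 ≤ p) (hMQ : M ≤ Q) (hQ : 0 < Q) :
    3 / 4 ≤ ρ.real (Metric.closedBall (∫ y, y ∂ρ) (4 * Q)) := by
  have hmarkov := h.pow_mul_measureReal_compl_closedBall_le le_rfl hp (by linarith : 0 ≤ 4 * Q)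
  rw [probReal_compl_eq_one_sub Metric.isClosed_closedBall.measurableSet, pow_one] at hmarkov
  by_contra! hlt
  nlinarith

lemma HasMomentBound.abs_integral_sub_le_add (h : HasMomentBound ρ p M) (hp : 2 ≤ p)
    {f : EuclideanSpace ℝ (Fin d) → ℝ} {A a s : ℝ} (hA : 0 ≤ A) (hR : 1 ≤ R) (hf : Measurable f)
    (hfA : ∀ x, |f x| ≤ A * (1 + ‖x - ∫ y, y ∂ρ‖ ^ 2))
    (hs : |∫ x in Metric.closedBall (∫ y, y ∂ρ) R, f x ∂ρ - s| ≤ a) :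
    |∫ x, f x ∂ρ - s| ≤ a + 2 * A * M / R ^ (p - 2) := by
  have htail := h.abs_setIntegral_compl_closedBall_le hp hA hR hfA
  rw [← integral_add_compl (Metric.isClosed_closedBall (x := ∫ y, y ∂ρ) (ε := R)).measurableSet
    (h.integrable_of_abs_le hp hf hfA), add_sub_right_comm]
  exact (abs_add_le _ _).trans (add_le_add hs htail)

lemma HasMomentBound.forall_mogClass_abs_integral_sub_le (hM : HasMomentBound ρ p M) (hp : 2 ≤ p)
    (hσ₁ : 0 < σ₁) (hσ : σ₁ ≤ σ₂) (hQ : 1 + d + k + |c| + M + σ₂ + 1 / σ₁ ≤ Q) (hm : 0 < m)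
    (hR : 1 ≤ R) {a : ℝ} {x : Fin m → EuclideanSpace ℝ (Fin d)}
    (hhalf : 1 / 2 ≤ (empiricalMeasure x).real (Metric.closedBall (∫ y, y ∂ρ) (4 * Q)))
    (hdev : ∀ θ : MixtureParams d, θ.IsControlled Q → θ.size ≤ k →
      (∀ y, |mixtureScore θ y| ≤ 100 * Q ^ 4 * (1 + ‖y - ∫ y, y ∂ρ‖ ^ 2)) →
      |∫ y in Metric.closedBall (∫ y, y ∂ρ) R, mixtureScore θ y ∂ρ -
        (m : ℝ)⁻¹ * ∑ j, mixtureScore θ (x j)| ≤ a) :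
    ∀ θ ∈ mogClass (empiricalMeasure x) c k σ₁ σ₂ ∪ mogClass ρ c k σ₁ σ₂,
      Integrable (mixtureScore θ) ρ ∧
        |∫ y, mixtureScore θ y ∂ρ - ∫ y, mixtureScore θ y ∂(empiricalMeasure x)| ≤
          a + 2 * (100 * Q ^ 4) * M / R ^ (p - 2) := by
  have hMnonneg := hM.nonneg (one_le_two.trans hp)
  have hσ₁inv : 0 < 1 / σ₁ := one_div_pos.2 hσ₁
  have hc := abs_nonneg c
  have := d.cast_nonneg (α := ℝ)
  have := k.cast_nonneg (α := ℝ)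
  intro θ hθ
  obtain ⟨ν, hνprob, hν, hθν⟩ : ∃ ν : Measure (EuclideanSpace ℝ (Fin d)), IsProbabilityMeasure ν ∧
      1 / 2 ≤ ν.real (Metric.closedBall (∫ y, y ∂ρ) (4 * Q)) ∧ θ ∈ mogClass ν c k σ₁ σ₂ := by
    rcases hθ with hθ | hθ
    · exact ⟨_, isProbabilityMeasure_empiricalMeasure hm x, hhalf, hθ⟩
    · have hmass := hM.three_fourths_le_measureReal_closedBall (Q := Q) (one_le_two.trans hp)
        (by linarith) (by linarith)
      exact ⟨ρ, inferInstance, by linarith, hθ⟩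
  have hcontrol : θ.IsControlled Q := MixtureParams.isControlled_of_mem_mogClass hθν hσ₁
    (by linarith) (by linarith) (by linarith) (by linarith)
  have hgrowth := MixtureParams.abs_mixtureScore_le_of_mem_mogClass hθν hcontrol (by linarith) hν
  refine ⟨hM.integrable_of_abs_le hp θ.measurable_mixtureScore hgrowth, ?_⟩
  rw [integral_empiricalMeasure]
  exact hM.abs_integral_sub_le_add hp (by positivity) hR θ.measurable_mixtureScore hgrowth
    (hdev θ hcontrol hθν.1 hgrowth)

lemma measure_pi_not_forall_mogClass_abs_integral_sub_le (hp : 2 ≤ p) (hM : HasMomentBound ρ p M)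
    (hσ₁ : 0 < σ₁) (hσ : σ₁ ≤ σ₂) (hm : 0 < m) (hδ : 0 < δ) (hmδ : 8 * Real.log (1 / δ) ≤ m)
    (hQ : 1 + d + k + |c| + M + σ₂ + 1 / σ₁ ≤ Q) (hR : 1 ≤ R) (hMR : m * M ≤ δ * R ^ p)
    (hL : 0 ≤ L)
    (hlog : Real.log 2 + Q ^ 3 * Real.log (2 ^ 11 * (Q ^ 8 * R ^ 4 * m ^ 2)) +
      Real.log (1 / δ) ≤ L) :
    (Measure.pi fun _ : Fin m => ρ) {x | ¬ ∀ θ ∈ mogClass (empiricalMeasure x) c k σ₁ σ₂ ∪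
        mogClass ρ c k σ₁ σ₂, Integrable (mixtureScore θ) ρ ∧
          |∫ y, mixtureScore θ y ∂ρ - ∫ y, mixtureScore θ y ∂(empiricalMeasure x)| ≤
            200 * Q ^ 4 * R ^ 2 * √(2 * L / m) + 4 / m + 2 * (100 * Q ^ 4) * M / R ^ (p - 2)} ≤
      ENNReal.ofReal (4 * δ) := by
  set x₀ := ∫ y, y ∂ρ
  have hMnonneg := hM.nonneg (one_le_two.trans hp)
  have hσ₁inv : 0 < 1 / σ₁ := one_div_pos.2 hσ₁
  have hcnonneg := abs_nonneg c
  have := d.cast_nonneg (α := ℝ)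
  have := k.cast_nonneg (α := ℝ)
  have hmass := hM.three_fourths_le_measureReal_closedBall (Q := Q) (one_le_two.trans hp)
    (by linarith) (by linarith)
  have hhalf := measure_pi_empiricalMeasure_lt_half_le hm ρ measurableSet_closedBall hmass hδ hmδ
  have houtside := measure_pi_exists_mem_le (m := m) ρ
    (Metric.isClosed_closedBall (x := x₀) (ε := R)).measurableSet.compl
  have hdeviation := measure_pi_exists_isControlled_lt_abs_le ρ hm x₀ (Q := Q) (k := k)
    (by linarith) (by linarith) hR hδ hL hlog
  have houtside_le : m * ρ.real (Metric.closedBall x₀ R)ᶜ ≤ δ := by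
    have hmarkov := hM.pow_mul_measureReal_compl_closedBall_le (one_le_two.trans hp) le_rfl
      (zero_le_one.trans hR)
    refine le_of_mul_le_mul_left ?_ (pow_pos (zero_lt_one.trans_le hR) p)
    nlinarith [mul_le_mul_of_nonneg_left hmarkov (m.cast_nonneg (α := ℝ))]
  calc _ ≤ _ := measure_mono fun x hx => ?_
    _ ≤ _ := (measure_union_le _ _).trans
      (add_le_add ((measure_union_le _ _).trans (add_le_add hhalf houtside)) hdeviation)
    _ ≤ ENNReal.ofReal (2 * δ) + ENNReal.ofReal δ + ENNReal.ofReal δ := by gcongr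
    _ = ENNReal.ofReal (4 * δ) := by
      rw [← ENNReal.ofReal_add (by positivity) hδ.le, ← ENNReal.ofReal_add (by positivity) hδ.le]
      ring_nf
  by_contra hx'
  obtain ⟨⟨hxhalf, hxball⟩, hxdev⟩ := by simpa only [Set.mem_union, not_or] using hx'
  exact hx (hM.forall_mogClass_abs_integral_sub_le hp hσ₁ hσ hQ hm hR (not_lt.1 hxhalf)
    fun θ hθ hsize hgrowth => not_lt.1 fun hlt => hxdev
      ⟨fun j => not_not.1 fun hj => hxball ⟨j, hj⟩, θ, hθ, hsize, hgrowth, hlt⟩)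

lemma measure_pi_not_forall_mogClass_abs_integral_sub_le_rate (hp : 2 ≤ p)
    (hM : HasMomentBound ρ p M) (hσ₁ : 0 < σ₁) (hσ : σ₁ ≤ σ₂) (hm : 0 < m) (hδ : 0 < δ)
    (hδ₁ : δ ≤ 1) (hmδ : 8 * Real.log (1 / δ) ≤ m) (hpQ : p ≤ Q)
    (hQ : 1 + d + k + |c| + M + σ₂ + 1 / σ₁ ≤ Q) :
    (Measure.pi fun _ : Fin m => ρ) {x | ¬ ∀ θ ∈ mogClass (empiricalMeasure x) c k σ₁ σ₂ ∪
        mogClass ρ c k σ₁ σ₂, Integrable (mixtureScore θ) ρ ∧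
          |∫ y, mixtureScore θ y ∂ρ - ∫ y, mixtureScore θ y ∂(empiricalMeasure x)| ≤
            1404 * (Q ^ 8 * ((m : ℝ) ^ (-(1 / 2 : ℝ) + 3 / p) * (1 / δ) ^ (4 / (p : ℝ))))} ≤
      ENNReal.ofReal (4 * δ) := by
  have hMnonneg := hM.nonneg (one_le_two.trans hp)
  have hMQ : M + 1 ≤ Q := by
    linarith [one_div_pos.2 hσ₁, abs_nonneg c, d.cast_nonneg (α := ℝ), k.cast_nonneg (α := ℝ)]
  have hQone : 1 ≤ Q := by linarith
  have hmone : (1 : ℝ) ≤ m := by exact_mod_cast hm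
  have hmpos : (0 : ℝ) < m := by exact_mod_cast hm
  have hδinv : 1 ≤ 1 / δ := one_le_one_div hδ hδ₁
  set X := (m : ℝ) ^ (p : ℝ)⁻¹
  set Y := (1 / δ) ^ (p : ℝ)⁻¹
  set R := truncationRadius p m M δ
  have hX : 1 ≤ X := Real.one_le_rpow hmone (by positivity)
  have hY : 1 ≤ Y := Real.one_le_rpow hδinv (by positivity)
  have hXR : X ≤ R := rpow_inv_le_truncationRadius p m hMnonneg hδ hδ₁
  have hRle : R ≤ Q * X * Y := (truncationRadius_le p m hMnonneg hδ).trans (by gcongr)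
  have hMR : m * M ≤ δ * R ^ p := by
    rw [truncationRadius_pow (by omega) m hMnonneg hδ, mul_one_div, mul_div_cancel₀ _ hδ.ne']
    linarith
  have hlog := log_netSize_le hQone hX hY (hX.trans hXR) hRle hmone
    ((log_le_natCast_mul_rpow_inv hmpos (by omega)).trans
      (mul_le_mul_of_nonneg_right hpQ (by positivity)))
    ((log_le_natCast_mul_rpow_inv (one_div_pos.2 hδ) (by omega)).trans
      (mul_le_mul_of_nonneg_right hpQ (by positivity)))
  refine (measure_mono ?_).trans (measure_pi_not_forall_mogClass_abs_integral_sub_le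
    hp hM hσ₁ hσ hm hδ hmδ hQ (hX.trans hXR) hMR (by positivity) hlog)
  refine fun x hx hgood => hx fun θ hθ => ⟨(hgood θ hθ).1, (hgood θ hθ).2.trans ?_⟩
  rw [← rpow_inv_pow_mul_rpow_inv_pow_div_sqrt hmpos hδ]
  linarith [concentration_rate_le (m := (m : ℝ)) hX hY (by linarith) hRle,
    four_div_le_rate hQone hX hY hmone, tail_rate_le hp hQone (by linarith : M ≤ Q) hX hY hmone
      (Real.rpow_inv_natCast_pow m.cast_nonneg (by omega)) hXR]

end UniformDeviation

lemma exists_measurableSet_ofReal_one_sub_le {Ω : Type*} [MeasurableSpace Ω] {P : Measure Ω}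
    [IsProbabilityMeasure P] {s : Set Ω} {a : ℝ} (ha : 0 ≤ a) (hs : P s ≤ ENNReal.ofReal a) :
    ∃ G, MeasurableSet G ∧ ENNReal.ofReal (1 - a) ≤ P G ∧ ∀ x ∈ G, x ∉ s := by
  refine ⟨(toMeasurable P s)ᶜ, (measurableSet_toMeasurable P s).compl, ?_,
    fun x hx hxs => hx (subset_toMeasurable P s hxs)⟩
  rw [prob_compl_eq_one_sub (measurableSet_toMeasurable P s), measure_toMeasurable,
    ENNReal.ofReal_sub 1 ha, ENNReal.ofReal_one]
  exact tsub_le_tsub_left hs 1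

theorem mainTheorem6_general :
    ∃ (C : ℝ) (N : ℕ),
      ∀ (d k p m : ℕ) (M σ₁ σ₂ c δ : ℝ)
        (ρ : Measure (EuclideanSpace ℝ (Fin d))) [IsProbabilityMeasure ρ],
        2 ≤ p →
        HasMomentBound ρ p M →
        0 < σ₁ → σ₁ ≤ σ₂ → σ₁ ≤ 1 →
        0 < δ →
        8 * Real.log (1 / δ) ≤ (m : ℝ) →
        ∃ G : Set (Fin m → EuclideanSpace ℝ (Fin d)),
          MeasurableSet G ∧
          ENNReal.ofReal (1 - 5 * δ) ≤ Measure.pi (fun _ : Fin m => ρ) G ∧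
          ∀ x ∈ G,
            ∀ θ ∈ mogClass (empiricalMeasure x) c k σ₁ σ₂ ∪ mogClass ρ c k σ₁ σ₂,
              Integrable (mixtureScore θ) ρ ∧
              |∫ y, mixtureScore θ y ∂ρ - ∫ y, mixtureScore θ y ∂(empiricalMeasure x)| ≤
                C * (1 + p + d + k + |c| + M + σ₂ / σ₁ + 1 / σ₁) ^ N *
                  ((m : ℝ) ^ (-(1 / 2 : ℝ) + 3 / p) *
                    (1 + Real.sqrt (Real.log m + Real.log (1 / δ)) +
                      (1 / δ) ^ (4 / (p : ℝ)))) := by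
  refine ⟨1404, 8, fun d k p m M σ₁ σ₂ c δ ρ _ hp hM hσ₁ hσ hσ₁one hδ hmδ => ?_⟩
  rcases le_or_gt 1 δ with hδ₁ | hδ₁
  · refine ⟨∅, .empty, ?_, fun x hx => hx.elim⟩
    rw [ENNReal.ofReal_of_nonpos (by linarith)]
    exact zero_le
  have hm : 0 < m := by
    exact_mod_cast (by linarith [Real.log_pos (one_lt_one_div hδ hδ₁)] : (0 : ℝ) < m)
  have hMnonneg := hM.nonneg (one_le_two.trans hp)
  have hσ₁inv : 0 < 1 / σ₁ := one_div_pos.2 hσ₁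
  have hσ₂le : σ₂ ≤ σ₂ / σ₁ := le_div_self (hσ₁.le.trans hσ) hσ₁ hσ₁one
  set Q := 1 + p + d + k + |c| + M + σ₂ / σ₁ + 1 / σ₁
  have hpQ : p ≤ Q := by linarith [abs_nonneg c, d.cast_nonneg (α := ℝ), k.cast_nonneg (α := ℝ)]
  obtain ⟨G, hG, hGδ, hgood⟩ := exists_measurableSet_ofReal_one_sub_le (by positivity)
    (measure_pi_not_forall_mogClass_abs_integral_sub_le_rate (c := c) (k := k) hp hM hσ₁ hσ hm hδ
      hδ₁.le hmδ hpQ (by linarith [p.cast_nonneg (α := ℝ)]))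
  refine ⟨G, hG, (ENNReal.ofReal_le_ofReal (by linarith)).trans hGδ, fun x hx θ hθ => ?_⟩
  have hθgood := not_not.1 (hgood x hx) θ hθ
  refine ⟨hθgood.1, hθgood.2.trans ?_⟩
  rw [← mul_assoc]
  gcongr
  linarith [Real.sqrt_nonneg (Real.log m + Real.log (1 / δ))]

theorem mainTheorem6 :
    ∃ (C : ℝ) (N : ℕ),
      ∀ (d k p m : ℕ) (M σ₁ σ₂ c δ : ℝ)
        (ρ : Measure (EuclideanSpace ℝ (Fin d))) [IsProbabilityMeasure ρ],
        8 ≤ p → 4 ∣ p →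
        HasMomentBound ρ p M →
        0 < σ₁ → σ₁ ≤ σ₂ → σ₁ ≤ 1 →
        c ≤ 1 / 2 →
        0 < δ →
        ((p : ℝ) / ((2 : ℝ) ^ ((p : ℝ) / 4 + 2) * Real.exp 1)) ^ 2 ≤ (m : ℝ) →
        8 * Real.log (1 / δ) ≤ (m : ℝ) →
        (d : ℝ) ^ 2 * Real.log (Real.pi * σ₂) ^ 2 * Real.log (1 / δ) ≤ (m : ℝ) →
        ∃ G : Set (Fin m → EuclideanSpace ℝ (Fin d)),
          MeasurableSet G ∧
          ENNReal.ofReal (1 - 5 * δ) ≤ Measure.pi (fun _ : Fin m => ρ) G ∧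
          ∀ x ∈ G,
            ∀ θ ∈ mogClass (empiricalMeasure x) c k σ₁ σ₂ ∪ mogClass ρ c k σ₁ σ₂,
              Integrable (mixtureScore θ) ρ ∧
              |∫ y, mixtureScore θ y ∂ρ - ∫ y, mixtureScore θ y ∂(empiricalMeasure x)| ≤
                C * (1 + p + d + k + |c| + M + σ₂ / σ₁ + 1 / σ₁) ^ N *
                  ((m : ℝ) ^ (-(1 / 2 : ℝ) + 3 / p) *
                    (1 + Real.sqrt (Real.log m + Real.log (1 / δ)) +
                      (1 / δ) ^ (4 / (p : ℝ)))) := by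
  obtain ⟨C, N, h⟩ := mainTheorem6_general
  exact ⟨C, N, fun d k p m M σ₁ σ₂ c δ ρ _ hp _ hM hσ₁ hσ hσ₁one _ hδ _ hmδ _ =>
    h d k p m M σ₁ σ₂ c δ ρ (by omega) hM hσ₁ hσ hσ₁one hδ hmδ⟩
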